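/- Let $k$ be a field. Let $\mathrm{Mag}$ be the free symmetric $k$-linear operad on one binary operation without symmetry. Let $\mathrm{Alt}$ be the operad of alternative algebras, i.e. the quotient of $\mathrm{Mag}$ by the operadic ideal generated by the (linearized) identities $$(ab)c-a(bc)=-(ba)c+b(ac),\qquad (ab)c-a(bc)=-(ac)b+a(cb),$$ and let $\mathrm{Nov}$ be the operad of Novikov algebras, i.e. the quotient of $\mathrm{Mag}$ by the operadic ideal generated by $$(ab)c=(ac)b,\qquad (ab)c-a(bc)=(ba)c-b(ac).$$ Let $\mathrm{Alt}\otimes\mathrm{Nov}$ be their Hadamard product, $(\mathrm{Alt}\otimes\mathrm{Nov})(n)=\mathrm{Alt}(n)\otimes_k\mathrm{Nov}(n)$ with the diagonal actions of the symmetric groups and componentwise composition, and let the white Manin product $\mathrm{Alt}\circ\mathrm{Nov}$ be the suboperad of $\mathrm{Alt}\otimes\mathrm{Nov}$ generated by $\mathrm{Alt}(2)\otimes\mathrm{Nov}(2)$. Then the white Manin product coincides with the Hadamard product: $$\mathrm{Alt}\circ\mathrm{Nov}=\mathrm{Alt}\otimes\mathrm{Nov}.$$ -/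

import Mathlib

open TensorProduct

universe u

/-! ### Symmetric operads over a commutative ring -/

namespace OperadIndex

/-- The bijection moving the marked point out of the right summand. -/
def sumOption (α β : Type) : α ⊕ Option β ≃ Option (α ⊕ β) where
  toFun
    | .inl a => some (.inl a)
    | .inr none => none
    | .inr (some b) => some (.inr b)
  invFun
    | none => .inr none
    | some (.inl a) => .inl a
    | some (.inr b) => .inr (some b)
  left_inv := by rintro (a | _ | b) <;> rfl
  right_inv := by rintro (_ | a | b) <;> rfl

/-- The bijection moving the marked point out of the left summand. -/
def optionSum (α β : Type) : Option α ⊕ β ≃ Option (α ⊕ β) where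
  toFun
    | .inl none => none
    | .inl (some a) => some (.inl a)
    | .inr b => some (.inr b)
  invFun
    | none => .inl none
    | some (.inl a) => .inl (some a)
    | some (.inr b) => .inr b
  left_inv := by rintro ((_ | a) | b) <;> rfl
  right_inv := by rintro (_ | a | b) <;> rfl

/-- The transposition of the two marked points. -/
def optionSwap (α : Type) : Option (Option α) ≃ Option (Option α) where
  toFun
    | none => some none
    | some none => none
    | some (some a) => some (some a)
  invFun
    | none => some none
    | some none => none
    | some (some a) => some (some a)
  left_inv := by rintro (_ | _ | a) <;> rfl
  right_inv := by rintro (_ | _ | a) <;> rfl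

/-- The bijection exchanging the last two summands. -/
def sumRightComm (α β γ : Type) : (α ⊕ γ) ⊕ β ≃ (α ⊕ β) ⊕ γ where
  toFun
    | .inl (.inl a) => .inl (.inl a)
    | .inl (.inr c) => .inr c
    | .inr b => .inl (.inr b)
  invFun
    | .inl (.inl a) => .inl (.inl a)
    | .inl (.inr b) => .inr b
    | .inr c => .inl (.inr c)
  left_inv := by rintro ((a | c) | b) <;> rfl
  right_inv := by rintro ((a | b) | c) <;> rfl

/-- The bijection from the one-point set to `Option Empty`. -/
def unitOption : Unit ≃ Option Empty where
  toFun _ := none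
  invFun _ := ()
  left_inv _ := rfl
  right_inv := by rintro (_ | a) <;> [rfl; exact a.elim]

end OperadIndex

open OperadIndex

/-- A symmetric `k`-linear operad, in coordinate-free form: `obj ι` is the module of operations
whose inputs are labelled by the finite set `ι` (so `obj (Fin n)` is the component of arity `n`),
`map` is the relabelling of inputs along bijections (for `ι = Fin n` this is the action of the
symmetric group), `one` is the identity operation, and `comp f g` is the partial composition that
inserts `g` into the input `none` of `f`. The axioms are functoriality, equivariance, the two unit
laws, and the sequential and the parallel associativity laws. -/
structure SymmOperad (k : Type u) [CommRing k] where
  obj : (ι : Type) → [Finite ι] → Type u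
  [addCommGroup : ∀ (ι : Type) [Finite ι], AddCommGroup (obj ι)]
  [module : ∀ (ι : Type) [Finite ι], Module k (obj ι)]
  map : ∀ {ι κ : Type} [Finite ι] [Finite κ], (ι ≃ κ) → (obj ι →ₗ[k] obj κ)
  one : obj Unit
  comp : ∀ {α β : Type} [Finite α] [Finite β],
    obj (Option α) →ₗ[k] obj β →ₗ[k] obj (α ⊕ β)
  map_refl : ∀ {ι : Type} [Finite ι] (f : obj ι), map (Equiv.refl ι) f = f
  map_trans : ∀ {ι κ μ : Type} [Finite ι] [Finite κ] [Finite μ] (e : ι ≃ κ) (e' : κ ≃ μ)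
    (f : obj ι), map (e.trans e') f = map e' (map e f)
  comp_map : ∀ {α α' β β' : Type} [Finite α] [Finite α'] [Finite β] [Finite β']
    (e : α ≃ α') (e' : β ≃ β') (f : obj (Option α)) (g : obj β),
    comp (map e.optionCongr f) (map e' g) = map (e.sumCongr e') (comp f g)
  one_comp : ∀ {β : Type} [Finite β] (g : obj β),
    comp (map unitOption one) g = map (Equiv.emptySum Empty β).symm g
  comp_one : ∀ {α : Type} [Finite α] (f : obj (Option α)),
    comp f one = map (Equiv.optionEquivSumPUnit α) f
  comp_seq : ∀ {α β γ : Type} [Finite α] [Finite β] [Finite γ]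
    (f : obj (Option α)) (g : obj (Option β)) (h : obj γ),
    comp (map (sumOption α β) (comp f g)) h
      = map (Equiv.sumAssoc α β γ).symm (comp f (comp g h))
  comp_par : ∀ {α β γ : Type} [Finite α] [Finite β] [Finite γ]
    (f : obj (Option (Option α))) (g : obj β) (h : obj γ),
    comp (map (optionSum α β) (comp f g)) h
      = map (sumRightComm α β γ)
          (comp (map (optionSum α γ) (comp (map (optionSwap α) f) h)) g)

namespace SymmOperad

attribute [instance] SymmOperad.addCommGroup SymmOperad.module

variable {k : Type u} [CommRing k]

/-! ### Suboperads -/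

/-- A suboperad: a family of submodules that contains the identity and is stable under
relabelling and partial composition. -/
@[ext]
structure SubOperad (P : SymmOperad k) where
  carrier : (ι : Type) → [Finite ι] → Submodule k (P.obj ι)
  one_mem : P.one ∈ carrier Unit
  map_mem : ∀ {ι κ : Type} [Finite ι] [Finite κ] (e : ι ≃ κ) {f : P.obj ι},
    f ∈ carrier ι → P.map e f ∈ carrier κ
  comp_mem : ∀ {α β : Type} [Finite α] [Finite β] {f : P.obj (Option α)} {g : P.obj β},
    f ∈ carrier (Option α) → g ∈ carrier β → P.comp f g ∈ carrier (α ⊕ β)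

/-- The whole operad as a suboperad of itself. -/
instance (P : SymmOperad k) : Top (SubOperad P) where
  top :=
    { carrier := fun _ _ => ⊤
      one_mem := trivial
      map_mem := fun _ _ _ => trivial
      comp_mem := fun _ _ => trivial }

/-- The smallest suboperad containing a given set `S` of operations of arity `n`. -/
def SubOperad.generate (P : SymmOperad k) (n : ℕ) (S : Set (P.obj (Fin n))) : SubOperad P where
  carrier := fun ι _ => ⨅ (Q : SubOperad P) (_ : ∀ f ∈ S, f ∈ Q.carrier (Fin n)), Q.carrier ι
  one_mem := by
    simp only [Submodule.mem_iInf]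
    exact fun Q _ => Q.one_mem
  map_mem := by
    intro ι κ _ _ e f hf
    simp only [Submodule.mem_iInf] at hf ⊢
    exact fun Q hQ => Q.map_mem e (hf Q hQ)
  comp_mem := by
    intro α β _ _ f g hf hg
    simp only [Submodule.mem_iInf] at hf hg ⊢
    exact fun Q hQ => Q.comp_mem (hf Q hQ) (hg Q hQ)

/-! ### Ideals and quotient operads -/

/-- An operadic ideal: a family of submodules stable under relabelling and under partial
composition with arbitrary operations on either side. -/
structure OperadIdeal (P : SymmOperad k) where
  carrier : (ι : Type) → [Finite ι] → Submodule k (P.obj ι)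
  map_mem : ∀ {ι κ : Type} [Finite ι] [Finite κ] (e : ι ≃ κ) {f : P.obj ι},
    f ∈ carrier ι → P.map e f ∈ carrier κ
  comp_mem_left : ∀ {α β : Type} [Finite α] [Finite β] {f : P.obj (Option α)} (g : P.obj β),
    f ∈ carrier (Option α) → P.comp f g ∈ carrier (α ⊕ β)
  comp_mem_right : ∀ {α β : Type} [Finite α] [Finite β] (f : P.obj (Option α)) {g : P.obj β},
    g ∈ carrier β → P.comp f g ∈ carrier (α ⊕ β)

/-- The smallest operadic ideal containing a given set `S` of operations of arity `n`. -/
def OperadIdeal.generate (P : SymmOperad k) (n : ℕ) (S : Set (P.obj (Fin n))) :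
    OperadIdeal P where
  carrier := fun ι _ => ⨅ (I : OperadIdeal P) (_ : ∀ f ∈ S, f ∈ I.carrier (Fin n)), I.carrier ι
  map_mem := by
    intro ι κ _ _ e f hf
    simp only [Submodule.mem_iInf] at hf ⊢
    exact fun I hI => I.map_mem e (hf I hI)
  comp_mem_left := by
    intro α β _ _ f g hf
    simp only [Submodule.mem_iInf] at hf ⊢
    exact fun I hI => I.comp_mem_left g (hf I hI)
  comp_mem_right := by
    intro α β _ _ f g hg
    simp only [Submodule.mem_iInf] at hg ⊢
    exact fun I hI => I.comp_mem_right f (hg I hI)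

/-- The partial composition of a quotient operad. -/
def quotientComp (P : SymmOperad k) (I : OperadIdeal P) (α β : Type) [Finite α] [Finite β] :
    (P.obj (Option α) ⧸ I.carrier (Option α)) →ₗ[k] (P.obj β ⧸ I.carrier β) →ₗ[k]
      (P.obj (α ⊕ β) ⧸ I.carrier (α ⊕ β)) :=
  (I.carrier (Option α)).liftQ
    (LinearMap.flip ((I.carrier β).liftQ
      (LinearMap.flip (P.comp.compr₂ (I.carrier (α ⊕ β)).mkQ))
      (by
        intro g hg
        rw [LinearMap.mem_ker]
        ext f
        exact (Submodule.Quotient.mk_eq_zero _).2 (I.comp_mem_right f hg))))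
    (by
      intro f hf
      rw [LinearMap.mem_ker]
      ext g
      exact (Submodule.Quotient.mk_eq_zero _).2 (I.comp_mem_left g hf))

/-- The quotient of an operad by an operadic ideal. -/
def quotient (P : SymmOperad k) (I : OperadIdeal P) : SymmOperad k where
  obj := fun ι _ => P.obj ι ⧸ I.carrier ι
  map := fun {ι κ} _ _ e =>
    (I.carrier ι).mapQ (I.carrier κ) (P.map e) (fun _ hf => I.map_mem e hf)
  one := Submodule.Quotient.mk P.one
  comp := fun {α β} _ _ => quotientComp P I α β
  map_refl := by
    intro ι _ f
    induction f using Submodule.Quotient.induction_on with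
    | H f => exact congrArg (Submodule.Quotient.mk) (P.map_refl f)
  map_trans := by
    intro ι κ μ _ _ _ e e' f
    induction f using Submodule.Quotient.induction_on with
    | H f => exact congrArg (Submodule.Quotient.mk) (P.map_trans e e' f)
  comp_map := by
    intro α α' β β' _ _ _ _ e e' f g
    induction f using Submodule.Quotient.induction_on with
    | H f =>
      induction g using Submodule.Quotient.induction_on with
      | H g => exact congrArg (Submodule.Quotient.mk) (P.comp_map e e' f g)
  one_comp := by
    intro β _ g
    induction g using Submodule.Quotient.induction_on with
    | H g => exact congrArg (Submodule.Quotient.mk) (P.one_comp g)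
  comp_one := by
    intro α _ f
    induction f using Submodule.Quotient.induction_on with
    | H f => exact congrArg (Submodule.Quotient.mk) (P.comp_one f)
  comp_seq := by
    intro α β γ _ _ _ f g h
    induction f using Submodule.Quotient.induction_on with
    | H f =>
      induction g using Submodule.Quotient.induction_on with
      | H g =>
        induction h using Submodule.Quotient.induction_on with
        | H h => exact congrArg (Submodule.Quotient.mk) (P.comp_seq f g h)
  comp_par := by
    intro α β γ _ _ _ f g h
    induction f using Submodule.Quotient.induction_on with
    | H f =>
      induction g using Submodule.Quotient.induction_on with
      | H g =>
        induction h using Submodule.Quotient.induction_on with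
        | H h => exact congrArg (Submodule.Quotient.mk) (P.comp_par f g h)

/-! ### The Hadamard product and the white Manin product -/

/-- The Hadamard product: `(P ⊗ Q)(ι) = P(ι) ⊗ Q(ι)` with componentwise relabelling (the diagonal
action of the symmetric groups) and componentwise composition. -/
noncomputable def hadamard (P Q : SymmOperad k) : SymmOperad k where
  obj := fun ι _ => P.obj ι ⊗[k] Q.obj ι
  map := fun e => TensorProduct.map (P.map e) (Q.map e)
  one := P.one ⊗ₜ[k] Q.one
  comp := fun {_ _} _ _ => TensorProduct.map₂ P.comp Q.comp
  map_refl := by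
    intro ι _ f
    induction f using TensorProduct.induction_on with
    | zero => simp
    | tmul a b => simp [P.map_refl, Q.map_refl]
    | add x y hx hy => simp only [map_add, hx, hy]
  map_trans := by
    intro ι κ μ _ _ _ e e' f
    induction f using TensorProduct.induction_on with
    | zero => simp
    | tmul a b => simp [P.map_trans, Q.map_trans]
    | add x y hx hy => simp only [map_add, hx, hy]
  comp_map := by
    intro α α' β β' _ _ _ _ e e' f g
    induction f using TensorProduct.induction_on with
    | zero => simp
    | add x y hx hy => simp only [map_add, LinearMap.add_apply, hx, hy]
    | tmul a b =>
      induction g using TensorProduct.induction_on with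
      | zero => simp
      | add x y hx hy => simp only [map_add, hx, hy]
      | tmul a' b' => simp [P.comp_map, Q.comp_map]
  one_comp := by
    intro β _ g
    induction g using TensorProduct.induction_on with
    | zero => simp
    | tmul a b => simp [P.one_comp, Q.one_comp]
    | add x y hx hy => simp only [map_add, hx, hy]
  comp_one := by
    intro α _ f
    induction f using TensorProduct.induction_on with
    | zero => simp
    | tmul a b => simp [P.comp_one, Q.comp_one]
    | add x y hx hy => simp only [map_add, LinearMap.add_apply, hx, hy]
  comp_seq := by
    intro α β γ _ _ _ f g h
    induction f using TensorProduct.induction_on with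
    | zero => simp
    | add x y hx hy => simp only [map_add, LinearMap.add_apply, hx, hy]
    | tmul a b =>
      induction g using TensorProduct.induction_on with
      | zero => simp
      | add x y hx hy => simp only [map_add, LinearMap.add_apply, hx, hy]
      | tmul a' b' =>
        induction h using TensorProduct.induction_on with
        | zero => simp
        | add x y hx hy => simp only [map_add, hx, hy]
        | tmul a'' b'' => simp [P.comp_seq, Q.comp_seq]
  comp_par := by
    intro α β γ _ _ _ f g h
    induction f using TensorProduct.induction_on with
    | zero => simp
    | add x y hx hy => simp only [map_add, LinearMap.add_apply, hx, hy]
    | tmul a b =>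
      induction g using TensorProduct.induction_on with
      | zero => simp
      | add x y hx hy => simp only [map_add, LinearMap.add_apply, hx, hy]
      | tmul a' b' =>
        induction h using TensorProduct.induction_on with
        | zero => simp
        | add x y hx hy => simp only [map_add, LinearMap.add_apply, hx, hy]
        | tmul a'' b'' =>
          simp only [TensorProduct.map₂_apply_tmul, TensorProduct.map_tmul]
          rw [P.comp_par, Q.comp_par]

/-- The white Manin product of two binary operads: the suboperad of the Hadamard product
generated by its component of arity two. -/
noncomputable def whiteManin (P Q : SymmOperad k) : SubOperad (hadamard P Q) :=
  SubOperad.generate (hadamard P Q) 2 Set.univ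

end SymmOperad

/-! ### The free operad on one binary operation without symmetry -/

/-- The multiset of leaves of a nonassociative monomial. -/
def FreeMagma.leaves {ι : Type} : FreeMagma ι → Multiset ι
  | .of i => {i}
  | .mul s t => s.leaves + t.leaves

/-- Multilinear nonassociative monomials: every variable from `ι` occurs exactly once. -/
def MultilinearMonomial (ι : Type) : Type :=
  {t : FreeMagma ι // t.leaves.Nodup ∧ ∀ i, i ∈ t.leaves}

namespace MultilinearMonomial

theorem leaves_lift {α β : Type} (φ : α → FreeMagma β) (t : FreeMagma α) :
    (FreeMagma.lift φ t).leaves = t.leaves.bind fun a => (φ a).leaves := by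
  induction t with
  | ih1 a => simp [FreeMagma.leaves]
  | ih2 s t hs ht =>
    have h : (s * t).leaves = s.leaves + t.leaves := rfl
    have h' : (FreeMagma.lift φ s * FreeMagma.lift φ t).leaves
      = (FreeMagma.lift φ s).leaves + (FreeMagma.lift φ t).leaves := rfl
    rw [map_mul, h', h, hs, ht, Multiset.add_bind]

theorem leaves_map {α β : Type} (φ : α → β) (t : FreeMagma α) :
    (FreeMagma.map φ t).leaves = t.leaves.map φ := by
  rw [FreeMagma.map, leaves_lift]
  exact Multiset.bind_singleton _ _

/-- Renaming of variables along a bijection. -/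
def map {ι κ : Type} (e : ι ≃ κ) (t : MultilinearMonomial ι) : MultilinearMonomial κ :=
  ⟨FreeMagma.map e t.1, by
    rw [leaves_map]
    refine ⟨t.2.1.map e.injective, fun i => ?_⟩
    exact Multiset.mem_map.2 ⟨e.symm i, t.2.2 _, e.apply_symm_apply i⟩⟩

/-- The one-variable monomial. -/
def one : MultilinearMonomial Unit :=
  ⟨FreeMagma.of (), by simp [FreeMagma.leaves]⟩

/-- The substitution that sends the variable `none` to `s` and keeps the other variables. -/
def substFun {α β : Type} (s : FreeMagma β) : Option α → FreeMagma (α ⊕ β)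
  | none => FreeMagma.map Sum.inr s
  | some a => FreeMagma.of (Sum.inl a)

/-- Substitution of a monomial for the variable `none`. -/
def comp {α β : Type} (t : MultilinearMonomial (Option α)) (s : MultilinearMonomial β) :
    MultilinearMonomial (α ⊕ β) :=
  ⟨FreeMagma.lift (substFun s.1) t.1, by
    rw [leaves_lift]
    constructor
    · rw [Multiset.nodup_bind]
      refine ⟨?_, t.2.1.pairwise ?_⟩
      · rintro (_ | a) -
        · simp only [substFun, leaves_map]
          exact s.2.1.map Sum.inr_injective
        · simp [substFun, FreeMagma.leaves]
      · rintro (_ | a) - (_ | b) - hab <;>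
          simp_all [Function.onFun, substFun, FreeMagma.leaves, leaves_map, eq_comm]
    · rintro (a | b) <;> rw [Multiset.mem_bind]
      · exact ⟨some a, t.2.2 _, by simp [substFun, FreeMagma.leaves]⟩
      · refine ⟨none, t.2.2 _, ?_⟩
        simp only [substFun, leaves_map]
        exact Multiset.mem_map_of_mem _ (s.2.2 b)⟩

theorem lift_lift {α β γ : Type} (φ : β → FreeMagma γ) (ψ : α → FreeMagma β) (t : FreeMagma α) :
    FreeMagma.lift φ (FreeMagma.lift ψ t) = FreeMagma.lift (fun a => FreeMagma.lift φ (ψ a)) t := by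
  induction t with
  | ih1 a => rfl
  | ih2 s t hs ht => simp only [map_mul, hs, ht]

theorem map_refl {ι : Type} (t : MultilinearMonomial ι) : map (Equiv.refl ι) t = t := by
  refine Subtype.ext ?_
  change FreeMagma.lift FreeMagma.of t.1 = t.1
  exact DFunLike.congr_fun
    (FreeMagma.hom_ext (f := FreeMagma.lift FreeMagma.of) (g := MulHom.id _) rfl) t.1

theorem map_trans {ι κ μ : Type} (e : ι ≃ κ) (e' : κ ≃ μ) (t : MultilinearMonomial ι) :
    map (e.trans e') t = map e' (map e t) :=
  Subtype.ext (lift_lift (FreeMagma.of ∘ e') (FreeMagma.of ∘ e) t.1).symm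

theorem comp_map {α α' β β' : Type} (e : α ≃ α') (e' : β ≃ β')
    (t : MultilinearMonomial (Option α)) (s : MultilinearMonomial β) :
    comp (map e.optionCongr t) (map e' s) = map (e.sumCongr e') (comp t s) := by
  refine Subtype.ext ?_
  simp only [comp, map, FreeMagma.map, lift_lift]
  congr 2
  funext a
  rcases a with _ | a
  · simp only [substFun, FreeMagma.map, lift_lift]
    simp [substFun, FreeMagma.map, lift_lift]
  · rfl

theorem one_comp {β : Type} (s : MultilinearMonomial β) :
    comp (map unitOption one) s = map (Equiv.emptySum Empty β).symm s :=
  Subtype.ext rfl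

theorem comp_one {α : Type} (t : MultilinearMonomial (Option α)) :
    comp t one = map (Equiv.optionEquivSumPUnit α) t := by
  refine Subtype.ext ?_
  simp only [comp, map, FreeMagma.map]
  congr 2
  funext a
  rcases a with _ | a <;> rfl

theorem comp_seq {α β γ : Type} (t : MultilinearMonomial (Option α))
    (s : MultilinearMonomial (Option β)) (r : MultilinearMonomial γ) :
    comp (map (sumOption α β) (comp t s)) r
      = map (Equiv.sumAssoc α β γ).symm (comp t (comp s r)) := by
  refine Subtype.ext ?_
  simp only [comp, map, FreeMagma.map, lift_lift]
  congr 2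
  funext a
  rcases a with _ | a
  · simp only [substFun, FreeMagma.map, lift_lift]
    congr 2
    funext b
    rcases b with _ | b
    · simp [substFun, FreeMagma.map, lift_lift, sumOption]
      rfl
    · rfl
  · rfl

theorem comp_par {α β γ : Type} (t : MultilinearMonomial (Option (Option α)))
    (s : MultilinearMonomial β) (r : MultilinearMonomial γ) :
    comp (map (optionSum α β) (comp t s)) r
      = map (sumRightComm α β γ)
          (comp (map (optionSum α γ) (comp (map (optionSwap α) t) r)) s) := by
  refine Subtype.ext ?_
  simp only [comp, map, FreeMagma.map, lift_lift]
  congr 2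
  funext a
  rcases a with _ | _ | a
  · simp [substFun, FreeMagma.map, lift_lift, optionSum, optionSwap]
    rfl
  · simp [substFun, FreeMagma.map, lift_lift, optionSum, optionSwap]
    rfl
  · rfl

end MultilinearMonomial

/-- The bilinear extension of substitution of monomials. -/
noncomputable def magComp (k : Type u) [CommRing k] (α β : Type) :
    (MultilinearMonomial (Option α) →₀ k) →ₗ[k] (MultilinearMonomial β →₀ k) →ₗ[k]
      (MultilinearMonomial (α ⊕ β) →₀ k) :=
  Finsupp.lift ((MultilinearMonomial β →₀ k) →ₗ[k] (MultilinearMonomial (α ⊕ β) →₀ k)) k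
    (MultilinearMonomial (Option α))
    (fun t => Finsupp.lmapDomain k k (MultilinearMonomial.comp t))

theorem magComp_single (k : Type u) [CommRing k] {α β : Type} (t : MultilinearMonomial (Option α))
    (s : MultilinearMonomial β) (a b : k) :
    magComp k α β (Finsupp.single t a) (Finsupp.single s b) = Finsupp.single (t.comp s) (a * b) := by
  simp [magComp, Finsupp.smul_single, -Finsupp.single_mul]

/-- The free operad generated by one binary operation without symmetry: `obj ι` is the free
module on the multilinear nonassociative monomials in the variables `ι`, and composition is
substitution. -/
noncomputable def magOperad (k : Type u) [CommRing k] : SymmOperad k where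
  obj := fun ι _ => MultilinearMonomial ι →₀ k
  map := fun e => Finsupp.lmapDomain k k (MultilinearMonomial.map e)
  one := Finsupp.single MultilinearMonomial.one 1
  comp := fun {α β} _ _ => magComp k α β
  map_refl := by
    intro ι _ f
    induction f using Finsupp.induction_linear with
    | zero => simp
    | add x y hx hy => simp only [map_add, hx, hy]
    | single t a => simp [MultilinearMonomial.map_refl]
  map_trans := by
    intro ι κ μ _ _ _ e e' f
    induction f using Finsupp.induction_linear with
    | zero => simp
    | add x y hx hy => simp only [map_add, hx, hy]
    | single t a => simp [MultilinearMonomial.map_trans]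
  comp_map := by
    intro α α' β β' _ _ _ _ e e' f g
    induction f using Finsupp.induction_linear with
    | zero => simp
    | add x y hx hy => simp only [map_add, LinearMap.add_apply, hx, hy]
    | single t a =>
      induction g using Finsupp.induction_linear with
      | zero => simp
      | add x y hx hy => simp only [map_add, hx, hy]
      | single s b => simp [magComp_single, MultilinearMonomial.comp_map, -Finsupp.single_mul]
  one_comp := by
    intro β _ g
    induction g using Finsupp.induction_linear with
    | zero => simp
    | add x y hx hy => simp only [map_add, hx, hy]
    | single s b => simp [magComp_single, MultilinearMonomial.one_comp, -Finsupp.single_mul]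
  comp_one := by
    intro α _ f
    induction f using Finsupp.induction_linear with
    | zero => simp
    | add x y hx hy => simp only [map_add, LinearMap.add_apply, hx, hy]
    | single t a => simp [magComp_single, MultilinearMonomial.comp_one, -Finsupp.single_mul]
  comp_seq := by
    intro α β γ _ _ _ f g h
    induction f using Finsupp.induction_linear with
    | zero => simp
    | add x y hx hy => simp only [map_add, LinearMap.add_apply, hx, hy]
    | single t a =>
      induction g using Finsupp.induction_linear with
      | zero => simp
      | add x y hx hy => simp only [map_add, LinearMap.add_apply, hx, hy]
      | single s b =>
        induction h using Finsupp.induction_linear with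
        | zero => simp
        | add x y hx hy => simp only [map_add, hx, hy]
        | single r c => simp [MultilinearMonomial.comp_seq, magComp_single, mul_assoc, -Finsupp.single_mul]
  comp_par := by
    intro α β γ _ _ _ f g h
    induction f using Finsupp.induction_linear with
    | zero => simp
    | add x y hx hy => simp only [map_add, LinearMap.add_apply, hx, hy]
    | single t a =>
      induction g using Finsupp.induction_linear with
      | zero => simp
      | add x y hx hy => simp only [map_add, LinearMap.add_apply, hx, hy]
      | single s b =>
        induction h using Finsupp.induction_linear with
        | zero => simp
        | add x y hx hy => simp only [map_add, LinearMap.add_apply, hx, hy]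
        | single r c =>
          simp only [magComp_single, Finsupp.lmapDomain_apply, Finsupp.mapDomain_single]
          rw [MultilinearMonomial.comp_par, mul_right_comm]

/-! ### The alternative and the Novikov operads -/

/-- The monomial `(x_a x_b) x_c` of arity three. -/
noncomputable def leftMonomial (k : Type u) [CommRing k] (a b c : Fin 3)
    (h : a ≠ b ∧ a ≠ c ∧ b ≠ c) : (magOperad k).obj (Fin 3) :=
  Finsupp.single (⟨(FreeMagma.of a * FreeMagma.of b) * FreeMagma.of c, by
    change ({a} + {b} + {c} : Multiset (Fin 3)).Nodup ∧ ∀ i, i ∈ ({a} + {b} + {c} : Multiset _)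
    revert a b c; decide⟩ : MultilinearMonomial (Fin 3)) (1 : k)

/-- The monomial `x_a (x_b x_c)` of arity three. -/
noncomputable def rightMonomial (k : Type u) [CommRing k] (a b c : Fin 3)
    (h : a ≠ b ∧ a ≠ c ∧ b ≠ c) : (magOperad k).obj (Fin 3) :=
  Finsupp.single (⟨FreeMagma.of a * (FreeMagma.of b * FreeMagma.of c), by
    change ({a} + ({b} + {c}) : Multiset (Fin 3)).Nodup ∧ ∀ i, i ∈ ({a} + ({b} + {c}) : Multiset _)
    revert a b c; decide⟩ : MultilinearMonomial (Fin 3)) (1 : k)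

/-- The operad of alternative algebras, with defining identities (in linearized form)
`(ab)c - a(bc) = -(ba)c + b(ac)` and `(ab)c - a(bc) = -(ac)b + a(cb)`. -/
noncomputable def altOperad (k : Type u) [CommRing k] : SymmOperad k :=
  (magOperad k).quotient (SymmOperad.OperadIdeal.generate (magOperad k) 3
    {leftMonomial k 0 1 2 (by decide) - rightMonomial k 0 1 2 (by decide)
        - (-leftMonomial k 1 0 2 (by decide) + rightMonomial k 1 0 2 (by decide)),
      leftMonomial k 0 1 2 (by decide) - rightMonomial k 0 1 2 (by decide)
        - (-leftMonomial k 0 2 1 (by decide) + rightMonomial k 0 2 1 (by decide))})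

/-- The operad of Novikov algebras, in the convention of the operation `a ≺ b = a d(b)` on a
commutative algebra with a derivation: right commutativity `(ab)c = (ac)b` and left symmetry
`(ab)c - a(bc) = (ba)c - b(ac)`. -/
noncomputable def novOperad (k : Type u) [CommRing k] : SymmOperad k :=
  (magOperad k).quotient (SymmOperad.OperadIdeal.generate (magOperad k) 3
    {leftMonomial k 0 1 2 (by decide) - leftMonomial k 0 2 1 (by decide),
      leftMonomial k 0 1 2 (by decide) - rightMonomial k 0 1 2 (by decide)
        - (leftMonomial k 1 0 2 (by decide) - rightMonomial k 1 0 2 (by decide))})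

/-! ### Evaluation of nonassociative monomials -/

namespace FreeMagma

variable {ι : Type}

/-! Both operads are quotients of Mag, so the Hadamard product in arity `ι` is spanned by tensors t
⊗ s of multilinear monomials. It suffices to find a pair of leaves whose product occurs as a
submonomial (a cherry) on both sides at once. Such a pair, za ⊗ za or az ⊗ za, is an operation of
arity two. Contracting it to one leaf leaves a tensor of smaller arity, and induction applies.

The pair is chosen by means of the left leaves of s, those that are left factors of their parent. In
the realization u d(v) of the Novikov product, they are the leaves left undifferentiated in the term
where each derivation lands on the last leaf of its argument. A monomial of arity at least two has a
left leaf and a leaf that is not left. Let Z be the set of left leaves of s.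

On the alternative side (`eval_mem_mixedSpan`), t is a combination of monomials having a cherry, in
one order or the other, with one leaf z in Z and one leaf a outside. The linearized alternative laws
turn a product of a Z-part with a non-Z-part into products in which smaller such parts meet, until
two leaves meet.

On the Novikov side (`gatherable`), for any left leaf z and non-left leaf a, s is a combination of
monomials with the cherry za and monomials with fewer left leaves. Right commutativity preserves the
number of left leaves and left symmetry, solved for u(vw), never raises it, so the exceptional terms
are handled by a second induction on this number. `tmul_eval_mem_span` combines the two.

These rewritings are carried out in relatively free algebras. The return to operads is the
projection `freeAlgPart` to the multilinear part, well defined because an operadic ideal is stable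
under arbitrary substitution followed by extraction of the multilinear part. No division occurs, so
the argument is valid over any commutative ring. -/

theorem leaves_of (i : ι) : (of i).leaves = {i} := rfl

theorem leaves_mul (s t : FreeMagma ι) : (s * t).leaves = s.leaves + t.leaves := rfl

theorem card_leaves_pos (t : FreeMagma ι) : 0 < t.leaves.card := by
  induction t with
  | ih1 i => simp [leaves_of]
  | ih2 s t hs ht => rw [leaves_mul, Multiset.card_add]; omega

/-- The value of a nonassociative monomial under a bilinear product `m`. -/
def eval {R A : Type*} [CommRing R] [AddCommGroup A] [Module R A] (m : A →ₗ[R] A →ₗ[R] A)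
    (x : ι → A) : FreeMagma ι → A
  | .of i => x i
  | .mul s t => m (eval m x s) (eval m x t)

section Eval

variable {R A : Type*} [CommRing R] [AddCommGroup A] [Module R A] (m : A →ₗ[R] A →ₗ[R] A)

theorem eval_of (x : ι → A) (i : ι) : eval m x (of i) = x i := rfl

theorem eval_mul (x : ι → A) (s t : FreeMagma ι) :
    eval m x (s * t) = m (eval m x s) (eval m x t) := rfl

theorem eval_congr {x y : ι → A} {t : FreeMagma ι} (h : ∀ i ∈ t.leaves, x i = y i) :
    eval m x t = eval m y t := by
  induction t with
  | ih1 i => exact h i (by simp [leaves_of])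
  | ih2 s t hs ht =>
    simp only [leaves_mul, Multiset.mem_add] at h
    rw [eval_mul, eval_mul, hs fun i hi => h i (.inl hi), ht fun i hi => h i (.inr hi)]

theorem eval_update_of_notMem [DecidableEq ι] {x : ι → A} {t : FreeMagma ι} {r : ι} (w : A)
    (h : r ∉ t.leaves) : eval m (Function.update x r w) t = eval m x t :=
  eval_congr m fun _ hi => Function.update_of_ne (ne_of_mem_of_not_mem hi h) _ _

end Eval

/-- `HasCherry p q t` says that the product of the leaves `p` and `q` is a submonomial of `t`. -/
inductive HasCherry (p q : ι) : FreeMagma ι → Prop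
  | base : HasCherry p q (of p * of q)
  | left {s : FreeMagma ι} (t : FreeMagma ι) : HasCherry p q s → HasCherry p q (s * t)
  | right (s : FreeMagma ι) {t : FreeMagma ι} : HasCherry p q t → HasCherry p q (s * t)

/-- A cherry can be contracted to a single leaf, labelled by either of its two leaves. -/
theorem HasCherry.contract [DecidableEq ι] {p q r d : ι}
    (hr : (r = p ∧ d = q) ∨ (r = q ∧ d = p)) {t : FreeMagma ι} (ht : HasCherry p q t)
    (hn : t.leaves.Nodup) :
    ∃ t' : FreeMagma ι, t'.leaves + {d} = t.leaves ∧
      ∀ {R A : Type u} [CommRing R] [AddCommGroup A] [Module R A] (m : A →ₗ[R] A →ₗ[R] A)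
        (x : ι → A), eval m x t = eval m (Function.update x r (m (x p) (x q))) t' := by
  -- The surviving label `r` lies in the factor containing the cherry. By multilinearity it is
  -- absent from the other factor, whose value is therefore unaffected by the update at `r`.
  have key : ∀ {s : FreeMagma ι}, HasCherry p q s → r ∈ s.leaves := by
    intro s hs
    induction hs with
    | base => rcases hr with ⟨rfl, rfl⟩ | ⟨rfl, rfl⟩ <;> simp [leaves_mul, leaves_of]
    | left t _ ih => exact Multiset.mem_add.2 (.inl ih)
    | right s _ ih => exact Multiset.mem_add.2 (.inr ih)
  induction ht with
  | base =>
    refine ⟨of r, ?_, fun m x => ?_⟩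
    · rcases hr with ⟨rfl, rfl⟩ | ⟨rfl, rfl⟩ <;> simp [leaves_mul, leaves_of, add_comm]
    · simp [eval_mul, eval_of]
  | @left s t h ih =>
    rw [leaves_mul, Multiset.nodup_add] at hn
    obtain ⟨s', hs', hs⟩ := ih hn.1
    refine ⟨s' * t, ?_, fun m x => ?_⟩
    · rw [leaves_mul, leaves_mul, ← hs', add_right_comm]
    · rw [eval_mul, eval_mul, ← hs, eval_update_of_notMem]
      exact Multiset.disjoint_left.1 hn.2.2 (key h)
  | @right s t h ih =>
    rw [leaves_mul, Multiset.nodup_add] at hn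
    obtain ⟨t', ht', ht⟩ := ih hn.2.1
    refine ⟨s * t', ?_, fun m x => ?_⟩
    · rw [leaves_mul, leaves_mul, ← ht', add_assoc]
    · rw [eval_mul, eval_mul, ← ht, eval_update_of_notMem]
      exact fun hr => Multiset.disjoint_left.1 hn.2.2 hr (key h)

/-! ### Cherries in alternative algebras -/

section Alternative

variable {R A : Type*} [CommRing R] [AddCommGroup A] [Module R A] (m : A →ₗ[R] A →ₗ[R] A)
  (x : ι → A) (Z : ι → Prop)

/-- The span of the values of the monomials with leaves `S` that have a cherry with one leaf in `Z`
and one leaf outside of `Z`. -/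
def mixedSpan (S : Multiset ι) : Submodule R A :=
  Submodule.span R {v | ∃ t : FreeMagma ι, t.leaves = S ∧
    (∃ z a, Z z ∧ ¬ Z a ∧ (HasCherry z a t ∨ HasCherry a z t)) ∧ eval m x t = v}

variable {m x Z}

theorem mixedSpan_mul_right {S : Multiset ι} {v : A} (hv : v ∈ mixedSpan m x Z S)
    (u : FreeMagma ι) : m v (eval m x u) ∈ mixedSpan m x Z (S + u.leaves) := by
  induction hv using Submodule.span_induction with
  | mem v hv =>
    obtain ⟨t, rfl, ⟨z, a, hz, ha, h⟩, rfl⟩ := hv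
    exact Submodule.subset_span
      ⟨t * u, rfl, ⟨z, a, hz, ha, h.imp (HasCherry.left u) (HasCherry.left u)⟩, rfl⟩
  | zero => simp
  | add v w _ _ hv hw => rw [map_add, LinearMap.add_apply]; exact add_mem hv hw
  | smul c v _ hv => rw [map_smul, LinearMap.smul_apply]; exact Submodule.smul_mem _ _ hv

theorem mixedSpan_mul_left {S : Multiset ι} {v : A} (hv : v ∈ mixedSpan m x Z S)
    (u : FreeMagma ι) : m (eval m x u) v ∈ mixedSpan m x Z (u.leaves + S) := by
  induction hv using Submodule.span_induction with
  | mem v hv =>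
    obtain ⟨t, rfl, ⟨z, a, hz, ha, h⟩, rfl⟩ := hv
    exact Submodule.subset_span
      ⟨u * t, rfl, ⟨z, a, hz, ha, h.imp (HasCherry.right u) (HasCherry.right u)⟩, rfl⟩
  | zero => simp
  | add v w _ _ hv hw => rw [map_add]; exact add_mem hv hw
  | smul c v _ hv => rw [map_smul]; exact Submodule.smul_mem _ _ hv

/-- The hypothesis on leaves makes `u` and `v` homogeneous of opposite types. If a, b have one type
and c the other, the alternative laws express (ab)c and c(ab) through terms in which c is multiplied
by a alone or by b alone, so the recursion descends to a product of two leaves. These terms involve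
both orders of the factors, hence the conjunction. -/
theorem mul_mem_mixedSpan
    (hr : ∀ a b c, m (m a b) c = m a (m b c) - m (m a c) b + m a (m c b))
    (hl : ∀ a b c, m c (m a b) = m (m c a) b + m (m a c) b - m a (m c b)) (u : FreeMagma ι) :
    ∀ v : FreeMagma ι, (∀ i ∈ u.leaves, ∀ j ∈ v.leaves, (Z i ↔ ¬ Z j)) →
      m (eval m x u) (eval m x v) ∈ mixedSpan m x Z (u.leaves + v.leaves) ∧
      m (eval m x v) (eval m x u) ∈ mixedSpan m x Z (u.leaves + v.leaves) := by
  induction u with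
  | ih1 i =>
    intro v
    induction v with
    | ih1 j =>
      intro h
      have hij := h i (by simp [leaves_of]) j (by simp [leaves_of])
      have hc : ∃ z a, Z z ∧ ¬ Z a ∧ ((z = i ∧ a = j) ∨ (z = j ∧ a = i)) := by
        by_cases hi : Z i
        · exact ⟨i, j, hi, hij.1 hi, .inl ⟨rfl, rfl⟩⟩
        · exact ⟨j, i, by tauto, hi, .inr ⟨rfl, rfl⟩⟩
      obtain ⟨z, a, hz, ha, h⟩ := hc
      refine ⟨Submodule.subset_span ⟨of i * of j, rfl, ⟨z, a, hz, ha, ?_⟩, rfl⟩,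
        Submodule.subset_span ⟨of j * of i, add_comm _ _, ⟨z, a, hz, ha, ?_⟩, rfl⟩⟩ <;>
      rcases h with ⟨rfl, rfl⟩ | ⟨rfl, rfl⟩ <;> simp [HasCherry.base]
    | ih2 v w hv hw =>
      intro h
      simp only [leaves_mul, Multiset.mem_add] at h
      obtain ⟨hv₁, hv₂⟩ := hv fun i hi j hj => h i hi j (.inl hj)
      obtain ⟨hw₁, hw₂⟩ := hw fun i hi j hj => h i hi j (.inr hj)
      have e₁ : (of i).leaves + v.leaves + w.leaves = (of i).leaves + (v * w).leaves := by
        rw [leaves_mul, add_assoc]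
      have e₂ : v.leaves + ((of i).leaves + w.leaves) = (of i).leaves + (v * w).leaves := by
        rw [leaves_mul, add_left_comm]
      rw [eval_mul, hl (eval m x v), hr (eval m x v) (eval m x w)]
      refine ⟨sub_mem (add_mem ?_ ?_) ?_, add_mem (sub_mem ?_ ?_) ?_⟩
      · exact e₁ ▸ mixedSpan_mul_right hv₁ w
      · exact e₁ ▸ mixedSpan_mul_right hv₂ w
      · exact e₂ ▸ mixedSpan_mul_left hw₁ v
      · exact e₂ ▸ mixedSpan_mul_left hw₂ v
      · exact e₁ ▸ mixedSpan_mul_right hv₂ w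
      · exact e₂ ▸ mixedSpan_mul_left hw₁ v
  | ih2 s t hs ht =>
    intro v h
    simp only [leaves_mul, Multiset.mem_add] at h
    obtain ⟨hs₁, hs₂⟩ := hs v fun i hi j hj => h i (.inl hi) j hj
    obtain ⟨ht₁, ht₂⟩ := ht v fun i hi j hj => h i (.inr hi) j hj
    have e₁ : s.leaves + v.leaves + t.leaves = (s * t).leaves + v.leaves := by
      rw [leaves_mul, add_right_comm]
    have e₂ : s.leaves + (t.leaves + v.leaves) = (s * t).leaves + v.leaves := by
      rw [leaves_mul, add_assoc]
    -- A composite `u` is split for arbitrary `v`; the inner induction on `v` is needed only when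
    -- `u` is a leaf.
    rw [eval_mul, hl (eval m x s), hr (eval m x s) (eval m x t)]
    refine ⟨add_mem (sub_mem ?_ ?_) ?_, sub_mem (add_mem ?_ ?_) ?_⟩
    · exact e₂ ▸ mixedSpan_mul_left ht₁ s
    · exact e₁ ▸ mixedSpan_mul_right hs₁ t
    · exact e₂ ▸ mixedSpan_mul_left ht₂ s
    · exact e₁ ▸ mixedSpan_mul_right hs₂ t
    · exact e₁ ▸ mixedSpan_mul_right hs₁ t
    · exact e₂ ▸ mixedSpan_mul_left ht₂ s

/-- In an alternative algebra, every monomial with leaves inside and outside of `Z` is a combination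
of monomials with a mixed cherry. -/
theorem eval_mem_mixedSpan
    (hr : ∀ a b c, m (m a b) c = m a (m b c) - m (m a c) b + m a (m c b))
    (hl : ∀ a b c, m c (m a b) = m (m c a) b + m (m a c) b - m a (m c b)) (t : FreeMagma ι)
    (hZ : ∃ i ∈ t.leaves, Z i) (hZ' : ∃ i ∈ t.leaves, ¬ Z i) :
    eval m x t ∈ mixedSpan m x Z t.leaves := by
  induction t with
  | ih1 i =>
    obtain ⟨j, hj, h⟩ := hZ
    obtain ⟨j', hj', h'⟩ := hZ'
    simp only [leaves_of, Multiset.mem_singleton] at hj hj'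
    subst hj hj'
    exact absurd h h'
  | ih2 s t hs ht =>
    by_cases h₁ : (∃ i ∈ s.leaves, Z i) ∧ ∃ i ∈ s.leaves, ¬ Z i
    · exact mixedSpan_mul_right (hs h₁.1 h₁.2) t
    by_cases h₂ : (∃ i ∈ t.leaves, Z i) ∧ ∃ i ∈ t.leaves, ¬ Z i
    · exact mixedSpan_mul_left (ht h₂.1 h₂.2) s
    -- Neither factor is mixed while the product is, so the factors are homogeneous of opposite
    -- types.
    refine (mul_mem_mixedSpan hr hl s t fun i hi j hj => ?_).1
    simp only [leaves_mul, Multiset.mem_add] at hZ hZ'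
    grind

end Alternative

/-! ### Cherries in Novikov algebras -/

/-- The leaves of a monomial that are left factors; the flag says whether the whole monomial counts
as a left factor. -/
def leftLeaves : Bool → FreeMagma ι → Multiset ι
  | b, .of i => if b then {i} else 0
  | _, .mul s t => leftLeaves true s + leftLeaves false t

theorem leftLeaves_true_of (i : ι) : leftLeaves true (of i) = {i} := rfl

theorem leftLeaves_false_of (i : ι) : leftLeaves false (of i) = 0 := rfl

theorem leftLeaves_mul (b : Bool) (s t : FreeMagma ι) :
    leftLeaves b (s * t) = leftLeaves true s + leftLeaves false t := rfl

/-- The flag matters only for a single leaf, so moving a factor from the left to the right costs at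
most that one left leaf. -/
theorem eq_of_or_leftLeaves_eq (t : FreeMagma ι) :
    (∃ i, t = of i) ∨ leftLeaves false t = leftLeaves true t := by
  cases t with
  | of i => exact .inl ⟨i, rfl⟩
  | mul s t => exact .inr rfl

theorem leftLeaves_false_le (t : FreeMagma ι) : leftLeaves false t ≤ leftLeaves true t := by
  cases t with
  | of i => exact Multiset.zero_le _
  | mul s t => exact le_rfl

theorem leftLeaves_true_le (t : FreeMagma ι) : leftLeaves true t ≤ t.leaves := by
  induction t with
  | ih1 i => exact le_rfl
  | ih2 s t hs ht => exact add_le_add hs ((leftLeaves_false_le t).trans ht)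

theorem card_leftLeaves_true_pos (t : FreeMagma ι) : 0 < (leftLeaves true t).card := by
  induction t with
  | ih1 i => simp [leftLeaves_true_of]
  | ih2 s t hs ht => rw [leftLeaves_mul, Multiset.card_add]; omega

theorem card_leftLeaves_false_lt (t : FreeMagma ι) :
    (leftLeaves false t).card < t.leaves.card := by
  induction t with
  | ih1 i => simp [leftLeaves_false_of, leaves_of]
  | ih2 s t hs ht =>
    have := Multiset.card_le_card (leftLeaves_true_le s)
    rw [leftLeaves_mul, leaves_mul, Multiset.card_add, Multiset.card_add]
    omega

section Novikov

variable {R A : Type*} [CommRing R] [AddCommGroup A] [Module R A] (m : A →ₗ[R] A →ₗ[R] A)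
  (x : ι → A) (z a : ι)

/-- The span of the values of the monomials with leaves `S` that have the cherry `z * a` or fewer
than `n` left leaves. -/
def cherrySpan (S : Multiset ι) (n : ℕ) : Submodule R A :=
  Submodule.span R {v | ∃ t : FreeMagma ι, t.leaves = S ∧
    (HasCherry z a t ∨ (leftLeaves true t).card < n) ∧ eval m x t = v}

variable {m x z a}

theorem cherrySpan_mono {S S' : Multiset ι} {n n' : ℕ} {v : A} (hv : v ∈ cherrySpan m x z a S n)
    (hS : S = S') (hn : n ≤ n') : v ∈ cherrySpan m x z a S' n' := by
  subst hS
  refine Submodule.span_mono ?_ hv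
  rintro _ ⟨t, rfl, h, rfl⟩
  exact ⟨t, rfl, h.imp_right fun h => h.trans_le hn, rfl⟩

theorem eval_mem_cherrySpan_of_lt {t : FreeMagma ι} {S : Multiset ι} {n : ℕ}
    (hS : t.leaves = S) (hn : (leftLeaves true t).card < n) :
    eval m x t ∈ cherrySpan m x z a S n :=
  Submodule.subset_span ⟨t, hS, .inr hn, rfl⟩

theorem cherrySpan_mul_right {S : Multiset ι} {n : ℕ} {v : A} (hv : v ∈ cherrySpan m x z a S n)
    (u : FreeMagma ι) :
    m v (eval m x u) ∈ cherrySpan m x z a (S + u.leaves) (n + (leftLeaves false u).card) := by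
  induction hv using Submodule.span_induction with
  | mem v hv =>
    obtain ⟨t, rfl, h, rfl⟩ := hv
    refine Submodule.subset_span ⟨t * u, rfl, h.imp (HasCherry.left u) fun h => ?_, rfl⟩
    rw [leftLeaves_mul, Multiset.card_add]
    omega
  | zero => simp
  | add v w _ _ hv hw => rw [map_add, LinearMap.add_apply]; exact add_mem hv hw
  | smul c v _ hv => rw [map_smul, LinearMap.smul_apply]; exact Submodule.smul_mem _ _ hv

/-- As a right factor, a monomial has at most as many left leaves as it has on its own, so the
strict bound survives. -/
theorem cherrySpan_mul_left {S : Multiset ι} {n : ℕ} {v : A} (hv : v ∈ cherrySpan m x z a S n)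
    (u : FreeMagma ι) :
    m (eval m x u) v ∈ cherrySpan m x z a (u.leaves + S) ((leftLeaves true u).card + n) := by
  induction hv using Submodule.span_induction with
  | mem v hv =>
    obtain ⟨t, rfl, h, rfl⟩ := hv
    refine Submodule.subset_span ⟨u * t, rfl, h.imp (HasCherry.right u) fun h => ?_, rfl⟩
    have := Multiset.card_le_card (leftLeaves_false_le t)
    rw [leftLeaves_mul, Multiset.card_add]
    omega
  | zero => simp
  | add v w _ _ hv hw => rw [map_add]; exact add_mem hv hw
  | smul c v _ hv => rw [map_smul]; exact Submodule.smul_mem _ _ hv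

variable (m x z a)

/-- If `z` is a left leaf of `t` and `a` is another leaf, then `t` is a combination of monomials
with the cherry `z * a` and of monomials with fewer left leaves. -/
def Gatherable (t : FreeMagma ι) : Prop :=
  z ∈ leftLeaves true t → a ∈ t.leaves → a ∉ leftLeaves true t →
    eval m x t ∈ cherrySpan m x z a t.leaves (leftLeaves true t).card

variable {m x z a}

/-- Covers rewritings that may turn `z` into a right factor: in that event the number of left leaves
has dropped and nothing remains to be gathered. -/
theorem Gatherable.eval_mem {t : FreeMagma ι} (h : Gatherable m x z a t) {S : Multiset ι} {n : ℕ}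
    (hz : z ∈ leftLeaves true t ∨ (leftLeaves true t).card < n) (ha : a ∈ t.leaves)
    (ha' : a ∉ leftLeaves true t) (hS : t.leaves = S) (hn : (leftLeaves true t).card ≤ n) :
    eval m x t ∈ cherrySpan m x z a S n := by
  rcases hz with hz | hz
  · exact cherrySpan_mono (h hz ha ha') hS hn
  · exact eval_mem_cherrySpan_of_lt hS hz

theorem card_leftLeaves_false_le (t : FreeMagma ι) :
    (leftLeaves false t).card ≤ (leftLeaves true t).card :=
  Multiset.card_le_card (leftLeaves_false_le t)

theorem notMem_leftLeaves_false {t : FreeMagma ι} (h : a ∉ leftLeaves true t) :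
    a ∉ leftLeaves false t :=
  fun h' => h (Multiset.mem_of_le (leftLeaves_false_le t) h')

/-- A left leaf of `t` remains one when `t` becomes a right factor, or the number of left leaves
decreases. -/
theorem mem_or_card_lt {t : FreeMagma ι} (h : z ∈ leftLeaves true t) :
    z ∈ leftLeaves false t ∨ (leftLeaves false t).card < (leftLeaves true t).card := by
  rcases eq_of_or_leftLeaves_eq t with ⟨i, rfl⟩ | h'
  · exact .inr (by simp [leftLeaves_true_of, leftLeaves_false_of])
  · exact .inl (h' ▸ h)

/-- The case of a product whose left factor contains `a` and whose right factor contains `z`. -/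
theorem gatherable_mul
    (hrc : ∀ u v w, m (m u v) w = m (m u w) v)
    (hls : ∀ u v w, m u (m v w) = m (m u v) w - m (m v u) w + m v (m u w)) (w : FreeMagma ι) :
    ∀ y : FreeMagma ι,
      (∀ t : FreeMagma ι, t.leaves.card < (y * w).leaves.card → Gatherable m x z a t) →
      z ∈ leftLeaves false w → a ∈ y.leaves → a ∉ leftLeaves true y → a ∉ leftLeaves false w →
      eval m x (y * w) ∈ cherrySpan m x z a (y * w).leaves (leftLeaves true (y * w)).card := by
  -- The left factor `y` stays universally quantified, because left symmetry transfers a factor of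
  -- `w` to it.
  induction w with
  | ih1 i => simp [leftLeaves_false_of]
  | ih2 v w hv hw =>
    intro y ih hz hay hay' haw
    have hvf := card_leftLeaves_false_le v
    have hyf := card_leftLeaves_false_le y
    have hvp := card_leaves_pos v
    have hwp := card_leaves_pos w
    have hyp := card_leaves_pos y
    simp only [leftLeaves_mul, leaves_mul, Multiset.mem_add, Multiset.card_add, not_or]
      at ih hz haw ⊢
    have hay'' := notMem_leftLeaves_false hay'
    have hav := notMem_leftLeaves_false haw.1
    rcases hz with hz | hz
    · cases y with
      | of i =>
        simp only [leaves_of, leftLeaves_true_of] at hay hay'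
        exact absurd hay hay'
      | mul p q =>
        change eval m x (p * q * (v * w)) ∈ _
        change a ∈ (p * q).leaves at hay
        change a ∉ leftLeaves true (p * q) at hay'
        change ∀ t : FreeMagma ι,
          t.leaves.card < (p * q).leaves.card + (v.leaves.card + w.leaves.card) → _ at ih
        change _ ∈ cherrySpan m x z a ((p * q).leaves + (v.leaves + w.leaves))
          ((leftLeaves true (p * q)).card + _)
        have hpp := card_leaves_pos p
        have hqp := card_leaves_pos q
        have hpf := card_leftLeaves_false_le p
        simp only [leftLeaves_mul, leaves_mul, Multiset.mem_add, Multiset.card_add, not_or]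
          at hay hay' ih ⊢
        have hap := notMem_leftLeaves_false hay'.1
        rcases hay with hap' | haq
        -- Right commutativity gives (pq)(vw) = (p(vw))q, and the smaller monomial p(vw) contains
        -- both `z` and `a`.
        · have h := ih (p * (v * w)) (by simp only [leaves_mul, Multiset.card_add]; omega)
            (by simp [leftLeaves_mul, hz]) (by simp [leaves_mul, hap'])
            (by simp [leftLeaves_mul, hay', haw])
          rw [eval_mul, eval_mul, hrc]
          refine cherrySpan_mono (cherrySpan_mul_right h q) ?_ ?_
          · simp only [leaves_mul]; abel
          · simp only [leftLeaves_mul, Multiset.card_add]; omega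
        · have h₁ := ih (v * q) (by simp only [leaves_mul, Multiset.card_add]; omega)
            (by simp [leftLeaves_mul, hz]) (by simp [leaves_mul, haq])
            (by simp [leftLeaves_mul, hay', haw])
          have h₂ : eval m x (p * v * q) ∈ cherrySpan m x z a (p * v * q).leaves
              ((leftLeaves true p).card + (leftLeaves true v).card
                + (leftLeaves false q).card) := by
            refine (ih (p * v * q) (by simp only [leaves_mul, Multiset.card_add]; omega)).eval_mem
              ?_ (by simp [leaves_mul, haq]) (by simp [leftLeaves_mul, hay', hav]) rfl ?_
            -- If `v` is the leaf `z`, it stops being a left leaf in pv and the count falls below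
            -- the bound.
            · have := mem_or_card_lt hz
              simp only [leftLeaves_mul, Multiset.card_add, Multiset.mem_add]
              exact this.imp (fun h => .inl (.inr h)) fun h => by omega
            · simp only [leftLeaves_mul, Multiset.card_add]; omega
          -- Right commutativity brings (pq)(vw) to (p(vw))q, left symmetry expands p(vw), and right
          -- commutativity then brings `q`, with its leaf `a`, next to the factor that holds `z`.
          have key : eval m x (p * q * (v * w)) = m (eval m x (p * v * q)) (eval m x w)
              - m (m (eval m x (v * q)) (eval m x p)) (eval m x w)
              + m (eval m x (v * q)) (eval m x (p * w)) := by
            simp only [eval_mul]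
            rw [hrc, hls (eval m x p), map_add, map_sub, LinearMap.add_apply, LinearMap.sub_apply]
            congr 1
            · congr 1
              · rw [hrc]
              · rw [hrc, hrc (eval m x v)]
            · rw [hrc]
          rw [key]
          refine add_mem (sub_mem ?_ ?_) ?_
          · refine cherrySpan_mono (cherrySpan_mul_right h₂ w) ?_ ?_
            · simp only [leaves_mul]; abel
            · omega
          · refine cherrySpan_mono (cherrySpan_mul_right (cherrySpan_mul_right h₁ p) w) ?_ ?_
            · simp only [leaves_mul]; abel
            · simp only [leftLeaves_mul, Multiset.card_add]; omega
          · refine cherrySpan_mono (cherrySpan_mul_right h₁ (p * w)) ?_ ?_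
            · simp only [leaves_mul]; abel
            · simp only [leftLeaves_mul, Multiset.card_add]; omega
    -- Here `z` lies deeper on the right, and left symmetry gives y(vw) = (yv)w - (vy)w + v(yw). The
    -- first two terms have the shorter right factor `w`; in the third, yw has fewer leaves.
    · have h₁ := hw (y * v) (fun t ht => ih t (by
          simp only [leaves_mul, Multiset.card_add] at ht; omega)) hz
          (by simp [leaves_mul, hay]) (by simp [leftLeaves_mul, hay', hav]) haw.2
      have h₂ := hw (v * y) (fun t ht => ih t (by
          simp only [leaves_mul, Multiset.card_add] at ht; omega)) hz
          (by simp [leaves_mul, hay]) (by simp [leftLeaves_mul, hay'', haw]) haw.2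
      have h₃ := ih (y * w) (by simp only [leaves_mul, Multiset.card_add]; omega)
        (by simp [leftLeaves_mul, hz]) (by simp [leaves_mul, hay])
        (by simp [leftLeaves_mul, hay', haw])
      rw [eval_mul, eval_mul, hls]
      refine add_mem (sub_mem ?_ ?_) ?_
      · refine cherrySpan_mono h₁ ?_ ?_
        · simp only [leaves_mul]; abel
        · simp only [leftLeaves_mul, Multiset.card_add]; omega
      · refine cherrySpan_mono h₂ ?_ ?_
        · simp only [leaves_mul]; abel
        · simp only [leftLeaves_mul, Multiset.card_add]; omega
      · refine cherrySpan_mono (cherrySpan_mul_left h₃ v) ?_ ?_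
        · simp only [leaves_mul]; abel
        · simp only [leftLeaves_mul, Multiset.card_add]; omega

/-- In a Novikov algebra, every monomial with the left leaf `z` and the other leaf `a` is a
combination of monomials with the cherry `z * a` and of monomials with fewer left leaves. -/
theorem gatherable
    (hrc : ∀ u v w, m (m u v) w = m (m u w) v)
    (hls : ∀ u v w, m u (m v w) = m (m u v) w - m (m v u) w + m v (m u w)) (t : FreeMagma ι) :
    Gatherable m x z a t := by
  -- Induction on the number of leaves supplies `gatherable_mul` with its hypothesis on smaller
  -- monomials.
  induction hN : t.leaves.card using Nat.strong_induction_on generalizing t with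
  | _ N IH =>
  subst hN
  replace IH : ∀ s : FreeMagma ι, s.leaves.card < t.leaves.card → Gatherable m x z a s :=
    fun s hs => IH _ hs s rfl
  intro hz ha ha'
  cases t with
  | of i =>
    simp only [leaves_of, leftLeaves_true_of] at ha ha'
    exact absurd ha ha'
  | mul u v =>
  change eval m x (u * v) ∈ cherrySpan m x z a (u * v).leaves (leftLeaves true (u * v)).card
  change z ∈ leftLeaves true (u * v) at hz
  change a ∈ (u * v).leaves at ha
  change a ∉ leftLeaves true (u * v) at ha'
  change ∀ s : FreeMagma ι, s.leaves.card < (u * v).leaves.card → _ at IH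
  have hup := card_leaves_pos u
  have hvp := card_leaves_pos v
  simp only [leftLeaves_mul, leaves_mul, Multiset.mem_add, Multiset.card_add, not_or]
    at IH hz ha ha'
  obtain ⟨hau, hav⟩ := ha'
  have hau' := notMem_leftLeaves_false hau
  rcases ha with ha | ha
  · rcases hz with hz | hz
    · refine cherrySpan_mono (cherrySpan_mul_right (IH u (by omega) hz ha hau) v) rfl ?_
      simp [leftLeaves_mul]
    · refine gatherable_mul hrc hls v u (fun s hs => IH s ?_) hz ha hau hav
      simpa [leaves_mul] using hs
  cases v with
  | of j =>
    change eval m x (u * of j) ∈ cherrySpan m x z a (u * of j).leaves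
      (leftLeaves true (u * of j)).card
    change a ∈ (of j).leaves at ha
    change z ∈ _ ∨ z ∈ leftLeaves false (of j) at hz
    change ∀ s : FreeMagma ι, s.leaves.card < _ + (of j).leaves.card → _ at IH
    simp only [leaves_of, Multiset.mem_singleton, leftLeaves_false_of, Multiset.notMem_zero,
      or_false] at ha hz
    subst ha
    cases u with
    | of i =>
      change z ∈ ({i} : Multiset ι) at hz
      rw [Multiset.mem_singleton] at hz
      subst hz
      exact Submodule.subset_span ⟨of z * of a, rfl, .inl .base, rfl⟩
    | mul p q =>
      change eval m x (p * q * of a) ∈ cherrySpan m x z a (p * q * of a).leaves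
        (leftLeaves true (p * q * of a)).card
      change a ∉ leftLeaves true (p * q) at hau
      change z ∈ leftLeaves true (p * q) at hz
      change ∀ s : FreeMagma ι, s.leaves.card < (p * q).leaves.card + _ → _ at IH
      have hpp := card_leaves_pos p
      have hqp := card_leaves_pos q
      simp only [leftLeaves_mul, leaves_mul, Multiset.mem_add, Multiset.card_add, not_or]
        at IH hz hau
      -- Right commutativity moves `a` next to `p`. If `z` is in `p`, the factor pa is smaller; if
      -- `z` is in `q`, the leaves are placed as in `gatherable_mul`.
      have key : eval m x (p * q * of a) = m (eval m x (p * of a)) (eval m x q) := by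
        simp only [eval_mul]; rw [hrc]
      rw [key]
      rcases hz with hz | hz
      · have h := IH (p * of a) (by simp only [leaves_mul, Multiset.card_add]; omega)
          (by simp [leftLeaves_mul, hz]) (by simp [leaves_mul, leaves_of])
          (by simp [leftLeaves_mul, hau, leftLeaves_false_of])
        refine cherrySpan_mono (cherrySpan_mul_right h q) ?_ ?_
        · simp only [leaves_mul]; abel
        · simp only [leftLeaves_mul, Multiset.card_add]; omega
      · have h := gatherable_mul (m := m) (x := x) hrc hls q (p * of a) (fun s hs => IH s (by
            simp only [leaves_mul, Multiset.card_add] at hs; omega)) hz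
            (by simp [leaves_mul, leaves_of])
            (by simp [leftLeaves_mul, hau, leftLeaves_false_of]) hau.2
        refine cherrySpan_mono h ?_ ?_
        · simp only [leaves_mul]; abel
        · simp only [leftLeaves_mul, Multiset.card_add]; omega
  | mul v w =>
    change eval m x (u * (v * w)) ∈ cherrySpan m x z a (u * (v * w)).leaves
      (leftLeaves true (u * (v * w))).card
    change a ∈ (v * w).leaves at ha
    change a ∉ leftLeaves false (v * w) at hav
    change z ∈ _ ∨ z ∈ leftLeaves false (v * w) at hz
    change ∀ s : FreeMagma ι, s.leaves.card < _ + (v * w).leaves.card → _ at IH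
    have hvp := card_leaves_pos v
    have hwp := card_leaves_pos w
    have huf := card_leftLeaves_false_le u
    have hvf := card_leftLeaves_false_le v
    rcases hz with hz | hz
    swap
    · refine cherrySpan_mono (cherrySpan_mul_left (IH (v * w) (by omega) hz ha hav) u) rfl ?_
      simp [leftLeaves_mul]
    simp only [leftLeaves_mul, leaves_mul, Multiset.mem_add, Multiset.card_add, not_or]
      at IH ha hav
    have hav' := notMem_leftLeaves_false hav.1
    have hz' := mem_or_card_lt hz
    -- With `z` in `u` and `a` in the right factor, u(vw) becomes (uv)w - (vu)w + v(uw).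
    rw [eval_mul, eval_mul, hls]
    rcases ha with ha | ha
    · have h₁ := IH (u * v) (by simp only [leaves_mul, Multiset.card_add]; omega)
        (by simp [leftLeaves_mul, hz]) (by simp [leaves_mul, ha])
        (by simp [leftLeaves_mul, hau, hav'])
      have h₂ : eval m x (v * u) ∈ cherrySpan m x z a (v * u).leaves
          ((leftLeaves true v).card + (leftLeaves true u).card) := by
        refine (IH (v * u) (by simp only [leaves_mul, Multiset.card_add]; omega)).eval_mem
          ?_ (by simp [leaves_mul, ha]) (by simp [leftLeaves_mul, hau', hav]) rfl ?_
        · simp only [leftLeaves_mul, Multiset.card_add, Multiset.mem_add]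
          exact hz'.imp .inr fun h => by omega
        · simp only [leftLeaves_mul, Multiset.card_add]; omega
      have h₃ := gatherable_mul (m := m) (x := x) hrc hls (u * w) v (fun s hs => IH s (by
            simp only [leaves_mul, Multiset.card_add] at hs; omega))
            (by simp [leftLeaves_mul, hz]) ha hav.1 (by simp [leftLeaves_mul, hau, hav])
      refine add_mem (sub_mem ?_ ?_) ?_
      · refine cherrySpan_mono (cherrySpan_mul_right h₁ w) ?_ ?_
        · simp only [leaves_mul]; abel
        · simp only [leftLeaves_mul, Multiset.card_add]; omega
      · refine cherrySpan_mono (cherrySpan_mul_right h₂ w) ?_ ?_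
        · simp only [leaves_mul]; abel
        · simp only [leftLeaves_mul, Multiset.card_add]; omega
      · refine cherrySpan_mono h₃ ?_ ?_
        · simp only [leaves_mul]; abel
        · simp only [leftLeaves_mul, Multiset.card_add]; omega
    · have h₁ := IH (u * w) (by simp only [leaves_mul, Multiset.card_add]; omega)
        (by simp [leftLeaves_mul, hz]) (by simp [leaves_mul, ha])
        (by simp [leftLeaves_mul, hau, hav])
      have h₂ : eval m x (v * w * u) ∈ cherrySpan m x z a (v * w * u).leaves
          ((leftLeaves true v).card + (leftLeaves false w).card
            + (leftLeaves true u).card) := by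
        rcases hz' with hz' | hz'
        · refine cherrySpan_mono (gatherable_mul hrc hls u (v * w) (fun s hs => IH s (by
            simp only [leaves_mul, Multiset.card_add] at hs; omega)) hz'
            (by simp [leaves_mul, ha]) (by simp [leftLeaves_mul, hav]) hau') rfl ?_
          simp only [leftLeaves_mul, Multiset.card_add]; omega
        · refine eval_mem_cherrySpan_of_lt rfl ?_
          simp only [leftLeaves_mul, Multiset.card_add]; omega
      -- With `a` in `w`, the first two terms are turned into (uw)v and (vw)u, so that uw gathers by
      -- induction and (vw)u has `a` on the left and `z` on the right.
      rw [hrc (eval m x u), hrc (eval m x v)]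
      refine add_mem (sub_mem ?_ ?_) ?_
      · refine cherrySpan_mono (cherrySpan_mul_right h₁ v) ?_ ?_
        · simp only [leaves_mul]; abel
        · simp only [leftLeaves_mul, Multiset.card_add]; omega
      · refine cherrySpan_mono h₂ ?_ ?_
        · simp only [leaves_mul]; abel
        · simp only [leftLeaves_mul, Multiset.card_add]; omega
      · refine cherrySpan_mono (cherrySpan_mul_left h₁ v) ?_ ?_
        · simp only [leaves_mul]; abel
        · simp only [leftLeaves_mul, Multiset.card_add]; omega

end Novikov
-- Simultaneous contraction of cherries in tensor products
-- The last leaf of a product is a right factor; in the proof this is a count of left leaves against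
-- all leaves.
theorem exists_notMem_leftLeaves {t : FreeMagma ι} (hn : t.leaves.Nodup)
    (ht : 1 < t.leaves.card) : ∃ a ∈ t.leaves, a ∉ leftLeaves true t := by
  by_contra! h
  have h₁ := Multiset.card_le_card ((Multiset.le_iff_subset hn).2 h)
  have h₂ := card_leftLeaves_false_lt t
  rcases eq_of_or_leftLeaves_eq t with ⟨i, rfl⟩ | h'
  · simp [leaves_of] at ht
  · rw [h'] at h₂; omega

theorem eq_of_of_leaves_eq {t : FreeMagma ι} {i : ι} (h : t.leaves = {i}) : t = of i := by
  cases t with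
  | of j => rw [show j = i from Multiset.singleton_inj.1 h]
  | mul s t =>
    have := congrArg Multiset.card h
    change (s.leaves + t.leaves).card = _ at this
    have h₁ := card_leaves_pos s
    have h₂ := card_leaves_pos t
    rw [Multiset.card_add, Multiset.card_singleton] at this
    omega

/-- The tensor product of an alternative and a Novikov algebra: if two monomials have the same
leaves, each occurring once, then the tensor product of their values lies in the span of every set
of pure tensors that contains the tensor products of the values of the leaves and is stable under
the operations `ab ⊗ cd` and `ba ⊗ cd`. -/
theorem tmul_eval_mem_span {k A N : Type u} [CommRing k] [AddCommGroup A] [Module k A]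
    [AddCommGroup N] [Module k N] {mA : A →ₗ[k] A →ₗ[k] A} {mN : N →ₗ[k] N →ₗ[k] N}
    (hr : ∀ a b c, mA (mA a b) c = mA a (mA b c) - mA (mA a c) b + mA a (mA c b))
    (hl : ∀ a b c, mA c (mA a b) = mA (mA c a) b + mA (mA a c) b - mA a (mA c b))
    (hrc : ∀ u v w, mN (mN u v) w = mN (mN u w) v)
    (hls : ∀ u v w, mN u (mN v w) = mN (mN u v) w - mN (mN v u) w + mN v (mN u w))
    {G : A → N → Prop}
    (hG : ∀ {a b c d}, G a c → G b d → G (mA a b) (mN c d) ∧ G (mA b a) (mN c d))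
    (t s : FreeMagma ι) (hts : t.leaves = s.leaves) (hn : s.leaves.Nodup)
    (x : ι → A) (y : ι → N) (hxy : ∀ i, G (x i) (y i)) :
    eval mA x t ⊗ₜ[k] eval mN y s ∈ Submodule.span k {f | ∃ a c, G a c ∧ a ⊗ₜ[k] c = f} := by
  classical
  -- The valuations vary because a contraction changes the value at the surviving leaf. The inner
  -- induction, on left leaves, also varies `t`, since the alternative monomial has been replaced by
  -- one with a mixed cherry.
  induction hN : s.leaves.card using Nat.strong_induction_on generalizing t s x y with
  | _ n ihn =>
  induction hZ : (leftLeaves true s).card using Nat.strong_induction_on generalizing t s with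
  | _ l ihl =>
  subst hN hZ
  rcases Nat.lt_or_ge 1 s.leaves.card with h1 | h1
  swap
  · obtain ⟨i, hi⟩ := Multiset.card_eq_one.1 (le_antisymm h1 (card_leaves_pos s))
    rw [eq_of_of_leaves_eq hi, eq_of_of_leaves_eq (hts.trans hi)]
    exact Submodule.subset_span ⟨_, _, hxy i, rfl⟩
  obtain ⟨z₀, hz₀⟩ := Multiset.card_pos_iff_exists_mem.1 (card_leftLeaves_true_pos s)
  obtain ⟨a₀, ha₀, ha₀'⟩ := exists_notMem_leftLeaves hn h1
  have ht := eval_mem_mixedSpan (m := mA) (x := x) (Z := (· ∈ leftLeaves true s)) hr hl t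
    ⟨z₀, hts ▸ Multiset.mem_of_le (leftLeaves_true_le s) hz₀, hz₀⟩ ⟨a₀, hts ▸ ha₀, ha₀'⟩
  -- Forgetting the origin of the value permits linear induction over the span, with the other
  -- tensor factor fixed.
  generalize eval mA x t = v at ht
  induction ht using Submodule.span_induction with
  | zero => simp
  | add v w _ _ hv hw => rw [TensorProduct.add_tmul]; exact add_mem hv hw
  | smul c v _ hv => rw [← TensorProduct.smul_tmul']; exact Submodule.smul_mem _ _ hv
  | mem v hv =>
    obtain ⟨t', ht', ⟨z, a, hz, ha, hc⟩, rfl⟩ := hv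
    rw [hts] at ht'
    have ha' : a ∈ s.leaves := by
      have key : ∀ {p q : ι} {r : FreeMagma ι}, HasCherry p q r → p ∈ r.leaves ∧ q ∈ r.leaves := by
        intro p q r h
        induction h with
        | base => simp [leaves_mul, leaves_of]
        | left t _ ih => simp [leaves_mul, ih]
        | right t _ ih => simp [leaves_mul, ih]
      rcases hc with hc | hc
      · exact ht' ▸ (key hc).2
      · exact ht' ▸ (key hc).1
    have hs := gatherable (m := mN) (x := y) hrc hls s hz ha' ha
    generalize eval mN y s = v at hs
    induction hs using Submodule.span_induction with
    | zero => simp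
    | add v w _ _ hv hw => rw [TensorProduct.tmul_add]; exact add_mem hv hw
    | smul c v _ hv => rw [TensorProduct.tmul_smul]; exact Submodule.smul_mem _ _ hv
    | mem v hv =>
      obtain ⟨s', hs', hs | hs, rfl⟩ := hv
      swap
      · exact ihl _ hs t' s' (ht'.trans hs'.symm) (hs' ▸ hn)
          (congrArg _ hs') rfl
      obtain ⟨s'', hs'', es⟩ := hs.contract (.inl ⟨rfl, rfl⟩) (hs' ▸ hn)
      -- Both cherries are contracted to the label `z` and lose `a`, so the leaves still agree; the
      -- new pair of values at `z` is allowed by `hG`.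
      have finish : ∀ {t'' : FreeMagma ι} {w : A}, t''.leaves + {a} = t'.leaves →
          G w (mN (y z) (y a)) →
          eval mA (Function.update x z w) t'' ⊗ₜ[k]
            eval mN (Function.update y z (mN (y z) (y a))) s'' ∈
              Submodule.span k {f | ∃ a c, G a c ∧ a ⊗ₜ[k] c = f} := by
        intro t'' w ht'' hw
        refine ihn s''.leaves.card ?_ t'' s'' ?_ ?_ _ _ ?_ rfl
        · rw [← hs', ← hs'', Multiset.card_add]; simp
        · exact add_right_cancel (ht''.trans (ht'.trans (hs'.symm.trans hs''.symm)))
        · rw [← hs', ← hs''] at hn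
          exact (Multiset.nodup_add.1 hn).1
        · intro i
          by_cases hi : i = z
          · subst hi; simpa using hw
          · simpa [hi] using hxy i
      rw [es mN y]
      rcases hc with hc | hc
      · obtain ⟨t'', ht'', et⟩ := hc.contract (.inl ⟨rfl, rfl⟩) (ht' ▸ hn)
        rw [et mA x]
        exact finish ht'' (hG (hxy z) (hxy a)).1
      · obtain ⟨t'', ht'', et⟩ := hc.contract (.inr ⟨rfl, rfl⟩) (ht' ▸ hn)
        rw [et mA x]
        exact finish ht'' (hG (hxy z) (hxy a)).2

end FreeMagma

/-! ### Linear combinations of monomials and their multilinear parts -/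

namespace MultilinearMonomial

variable {ι κ : Type}

/-- The product of two multilinear monomials in disjoint sets of variables. -/
def mul (t : MultilinearMonomial ι) (s : MultilinearMonomial κ) : MultilinearMonomial (ι ⊕ κ) :=
  ⟨FreeMagma.map Sum.inl t.1 * FreeMagma.map Sum.inr s.1, by
    rw [FreeMagma.leaves_mul, leaves_map, leaves_map, Multiset.nodup_add]
    refine ⟨⟨t.2.1.map Sum.inl_injective, s.2.1.map Sum.inr_injective, ?_⟩, ?_⟩
    · rw [Multiset.disjoint_left]
      simp
    · rintro (i | i)
      · exact Multiset.mem_add.2 (.inl (Multiset.mem_map_of_mem _ (t.2.2 i)))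
      · exact Multiset.mem_add.2 (.inr (Multiset.mem_map_of_mem _ (s.2.2 i)))⟩

theorem mul_val (t : MultilinearMonomial ι) (s : MultilinearMonomial κ) :
    (t.mul s).1 = FreeMagma.map Sum.inl t.1 * FreeMagma.map Sum.inr s.1 := rfl

theorem map_val (e : ι ≃ κ) (t : MultilinearMonomial ι) : (t.map e).1 = FreeMagma.map e t.1 := rfl

/-- Every nonassociative monomial arises from a multilinear one by identifying variables. -/
theorem exists_map_eq (t : FreeMagma ι) : ∃ (κ : Type) (_ : Finite κ) (φ : κ → ι)
    (s : MultilinearMonomial κ), FreeMagma.map φ s.1 = t := by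
  induction t with
  | ih1 i => exact ⟨Unit, inferInstance, fun _ => i, one, rfl⟩
  | ih2 t₁ t₂ h₁ h₂ =>
    obtain ⟨κ₁, _, φ₁, s₁, rfl⟩ := h₁
    obtain ⟨κ₂, _, φ₂, s₂, rfl⟩ := h₂
    refine ⟨κ₁ ⊕ κ₂, inferInstance, Sum.elim φ₁ φ₂, s₁.mul s₂, ?_⟩
    rw [mul_val, FreeMagma.map, map_mul]
    simp only [FreeMagma.map, lift_lift]
    rfl

end MultilinearMonomial

open MultilinearMonomial SymmOperad

section Bridge

variable {k : Type u} [CommRing k] {ι κ μ : Type}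

/-- The multilinear polynomial `c t`. -/
noncomputable def magSingle {k : Type u} [CommRing k] [Finite κ] (t : MultilinearMonomial κ)
    (c : k) : (magOperad k).obj κ :=
  (Finsupp.single t c : MultilinearMonomial κ →₀ k)

theorem magOperad_induction [Finite κ] {p : (magOperad k).obj κ → Prop}
    (f : (magOperad k).obj κ) (zero : p 0) (add : ∀ f g, p f → p g → p (f + g))
    (single : ∀ (t : MultilinearMonomial κ) (c : k), p (magSingle t c)) : p f :=
  Finsupp.induction_linear (motive := p) f zero add single

/-- The substitution of arbitrary monomials for the variables of a multilinear polynomial. -/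
noncomputable def substMon (k : Type u) [CommRing k] [Finite κ] (σ : κ → FreeMagma ι) :
    (magOperad k).obj κ →ₗ[k] (FreeMagma ι →₀ k) :=
  Finsupp.lmapDomain k k fun t : MultilinearMonomial κ => FreeMagma.lift σ t.1

theorem substMon_single [Finite κ] (σ : κ → FreeMagma ι) (t : MultilinearMonomial κ) (c : k) :
    substMon k σ (magSingle t c) = Finsupp.single (FreeMagma.lift σ t.1) c :=
  Finsupp.mapDomain_single

theorem magOperad_map_single [Finite κ] [Finite μ] (e : κ ≃ μ) (t : MultilinearMonomial κ)
    (c : k) : (magOperad k).map e (magSingle t c) = magSingle (t.map e) c :=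
  Finsupp.mapDomain_single

theorem magOperad_comp_single [Finite κ] [Finite μ] (t : MultilinearMonomial (Option κ))
    (s : MultilinearMonomial μ) (b c : k) :
    (magOperad k).comp (magSingle t b) (magSingle s c)
      = magSingle (t.comp s) (b * c) :=
  magComp_single k t s b c

theorem substMon_map [Finite κ] [Finite μ] (σ : μ → FreeMagma ι) (e : κ ≃ μ)
    (f : (magOperad k).obj κ) : substMon k σ ((magOperad k).map e f) = substMon k (σ ∘ e) f := by
  induction f using magOperad_induction with
  | zero => simp only [map_zero]
  | add f g hf hg => simp only [map_add, hf, hg]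
  | single t c =>
    rw [magOperad_map_single, substMon_single, substMon_single, map_val, FreeMagma.map, lift_lift]
    rfl

/-- Partial composition is substitution into one variable; this allows a simultaneous substitution
to be built one variable at a time within an ideal. -/
theorem substMon_comp_single [Finite κ] [Finite μ] (σ : κ ⊕ μ → FreeMagma ι)
    (f : (magOperad k).obj (Option κ)) (s : MultilinearMonomial μ) :
    substMon k σ ((magOperad k).comp f (magSingle s 1)) =
      substMon k (fun i => i.elim (FreeMagma.lift (σ ∘ Sum.inr) s.1) (σ ∘ Sum.inl)) f := by
  induction f using magOperad_induction with
  | zero => simp only [map_zero, LinearMap.zero_apply]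
  | add f g hf hg => simp only [map_add, LinearMap.add_apply, hf, hg]
  | single t c =>
    rw [magOperad_comp_single, substMon_single, substMon_single, mul_one]
    congr 1
    change FreeMagma.lift σ (FreeMagma.lift _ t.1) = _
    rw [lift_lift]
    congr 2
    funext i
    rcases i with _ | i
    · simp only [substFun, FreeMagma.map, lift_lift]
      rfl
    · rfl

open Classical in
/-- The multilinear part of a monomial. -/
noncomputable def multilinearTerm (k : Type u) [CommRing k] [Finite ι] (t : FreeMagma ι) :
    (magOperad k).obj ι :=
  if h : t.leaves.Nodup ∧ ∀ i, i ∈ t.leaves then magSingle (⟨t, h⟩ : MultilinearMonomial ι) 1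
  else 0

/-- The projection of a nonassociative polynomial to its multilinear part. -/
noncomputable def multilinearPart (k : Type u) [CommRing k] (ι : Type) [Finite ι] :
    (FreeMagma ι →₀ k) →ₗ[k] (magOperad k).obj ι :=
  Finsupp.lift ((magOperad k).obj ι) k (FreeMagma ι) (multilinearTerm k)

theorem multilinearPart_single_eq [Finite ι] (t : FreeMagma ι) (c : k) :
    multilinearPart k ι (Finsupp.single t c) = c • multilinearTerm k t := by
  rw [multilinearPart, Finsupp.lift_apply]
  exact Finsupp.sum_single_index (zero_smul _ _)

theorem multilinearPart_single [Finite ι] (t : MultilinearMonomial ι) (c : k) :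
    multilinearPart k ι (Finsupp.single t.1 c) = magSingle t c := by
  rw [multilinearPart_single_eq, multilinearTerm, dif_pos t.2]
  exact (Finsupp.smul_single (α := MultilinearMonomial ι) c t 1).trans
    (by rw [smul_eq_mul, mul_one]; rfl)

theorem multilinearPart_single_of_not [Finite ι] {t : FreeMagma ι}
    (h : ¬ (t.leaves.Nodup ∧ ∀ i, i ∈ t.leaves)) (c : k) :
    multilinearPart k ι (Finsupp.single t c) = 0 := by
  rw [multilinearPart_single_eq, multilinearTerm, dif_neg h, smul_zero]

theorem multilinearPart_single_map [Finite ι] [Finite κ] (e : κ ≃ ι) (t : MultilinearMonomial κ)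
    (c : k) : multilinearPart k ι (Finsupp.single (FreeMagma.map e t.1) c)
      = (magOperad k).map e (magSingle t c) := by
  rw [magOperad_map_single, ← map_val, multilinearPart_single]

theorem multilinearPart_single_map_of_not [Finite ι] {φ : κ → ι} (h : ¬ Function.Bijective φ)
    (t : MultilinearMonomial κ) (c : k) :
    multilinearPart k ι (Finsupp.single (FreeMagma.map φ t.1) c) = 0 := by
  refine multilinearPart_single_of_not (fun h' => h ⟨fun i j hij => ?_, fun i => ?_⟩) c
  · rw [leaves_map] at h'
    exact Multiset.inj_on_of_nodup_map h'.1 i (t.2.2 i) j (t.2.2 j) hij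
  · obtain ⟨j, _, hj⟩ := Multiset.mem_map.1 (leaves_map φ t.1 ▸ h'.2 i)
    exact ⟨j, hj⟩

/-- A bijective renaming is a relabelling; any other repeats or omits a variable and so has no
multilinear part. -/
theorem multilinearPart_substMon_of [Finite ι] [Finite κ] (φ : κ → ι) (f : (magOperad k).obj κ) :
    (∃ e : κ ≃ ι, multilinearPart k ι (substMon k (FreeMagma.of ∘ φ) f)
      = (magOperad k).map e f) ∨ multilinearPart k ι (substMon k (FreeMagma.of ∘ φ) f) = 0 := by
  by_cases h : Function.Bijective φ
  · refine .inl ⟨Equiv.ofBijective φ h, ?_⟩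
    induction f using magOperad_induction with
    | zero => simp only [map_zero]
    | add f g hf hg => simp only [map_add, hf, hg]
    | single t c => rw [substMon_single, ← multilinearPart_single_map]; rfl
  · refine .inr ?_
    induction f using magOperad_induction with
    | zero => simp only [map_zero]
    | add f g hf hg => simp only [map_add, hf, hg, add_zero]
    | single t c => rw [substMon_single]; exact multilinearPart_single_map_of_not h t c

/-- Operadic ideals are stable under multilinear substitution. -/
theorem SymmOperad.OperadIdeal.multilinearPart_substMon_mem (J : OperadIdeal (magOperad k))
    [Finite ι] [Finite κ] (σ : κ → FreeMagma ι) {f : (magOperad k).obj κ} (hf : f ∈ J.carrier κ) :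
    multilinearPart k ι (substMon k σ f) ∈ J.carrier ι := by
  have of_mem : ∀ {α : Type} [Finite α] (φ : α → ι) {f : (magOperad k).obj α},
      f ∈ J.carrier α → multilinearPart k ι (substMon k (FreeMagma.of ∘ φ) f) ∈ J.carrier ι := by
    intro α _ φ f hf
    rcases multilinearPart_substMon_of φ f with ⟨e, h⟩ | h
    · exact h ▸ J.map_mem e hf
    · exact h ▸ zero_mem _
  -- `κ` holds the variables still to be substituted, and `β` those already replaced by fresh
  -- variables that are only to be renamed to letters of `ι`.
  have key : ∀ (β : Type) (_ : Finite κ) (_ : Finite β) (σ : κ → FreeMagma ι) (φ : β → ι)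
      (f : (magOperad k).obj (κ ⊕ β)), f ∈ J.carrier (κ ⊕ β) →
      multilinearPart k ι (substMon k (Sum.elim σ (FreeMagma.of ∘ φ)) f) ∈ J.carrier ι := by
    clear hf f σ
    induction κ using Finite.induction_empty_option with
    | of_equiv e ih =>
      intro β _ _ σ φ f hf
      have := Finite.of_equiv _ e.symm
      have h := ih β this inferInstance (σ ∘ e) φ _ (J.map_mem (e.symm.sumCongr (Equiv.refl β)) hf)
      rw [substMon_map] at h
      convert h using 4
      funext i
      rcases i with i | i <;> simp
    | h_empty =>
      intro β _ _ σ φ f hf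
      have h := of_mem (Sum.elim PEmpty.elim φ) hf
      convert h using 4
      funext i
      rcases i with i | i
      · exact i.elim
      · rfl
    | @h_option κ' _ ih =>
      intro β _ _ σ φ f hf
      -- The monomial for `none` is written as a renamed multilinear one. Inserting the latter is a
      -- partial composition, and its variables join `β`.
      obtain ⟨β', _, ψ, s, hs⟩ := exists_map_eq (σ none)
      have h := ih (β ⊕ β') inferInstance inferInstance (σ ∘ some) (Sum.elim φ ψ) _
        (J.map_mem (Equiv.sumAssoc κ' β β')
          (J.comp_mem_left (magSingle s 1) (J.map_mem (optionSum κ' β) hf)))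
      rw [substMon_map, substMon_comp_single, substMon_map] at h
      convert h using 4
      funext i
      rcases i with (_ | i) | i
      · exact hs.symm
      · rfl
      · rfl
  have h := key Empty inferInstance inferInstance σ Empty.elim _
    (J.map_mem (Equiv.sumEmpty κ Empty).symm hf)
  rw [substMon_map] at h
  exact h

end Bridge

/-! ### Relatively free algebras -/

section RelativelyFree

variable {k : Type u} [CommRing k] {ι κ μ : Type}

/-- The bilinear product of nonassociative polynomials. -/
noncomputable def polyMul (k : Type u) [CommRing k] (ι : Type) :
    (FreeMagma ι →₀ k) →ₗ[k] (FreeMagma ι →₀ k) →ₗ[k] (FreeMagma ι →₀ k) :=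
  Finsupp.lift ((FreeMagma ι →₀ k) →ₗ[k] (FreeMagma ι →₀ k)) k (FreeMagma ι)
    fun t => Finsupp.lmapDomain k k (t * ·)

theorem polyMul_single (t s : FreeMagma ι) (b c : k) :
    polyMul k ι (Finsupp.single t b) (Finsupp.single s c) = Finsupp.single (t * s) (b * c) := by
  simp [polyMul, Finsupp.smul_single, -Finsupp.single_mul]

namespace MultilinearMonomial

/-- The product of the marked variable and the other variable. -/
def markedMul : MultilinearMonomial (Option Unit) :=
  ⟨FreeMagma.of none * FreeMagma.of (some ()), by
    change ({none} + {some ()} : Multiset (Option Unit)).Nodup ∧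
      ∀ i, i ∈ ({none} + {some ()} : Multiset (Option Unit))
    decide⟩

/-- The product of the other variable and the marked variable. -/
def mulMarked : MultilinearMonomial (Option Unit) :=
  ⟨FreeMagma.of (some ()) * FreeMagma.of none, by
    change ({some ()} + {none} : Multiset (Option Unit)).Nodup ∧
      ∀ i, i ∈ ({some ()} + {none} : Multiset (Option Unit))
    decide⟩

end MultilinearMonomial

/-- Together with `substMon_comp_mulMarked`, exhibits multiplication by a monomial as a partial
composition, whence `substSpan` is a two-sided ideal for `polyMul`. -/
theorem substMon_comp_markedMul [Finite κ] (τ : Unit ⊕ κ → FreeMagma ι)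
    (f : (magOperad k).obj κ) :
    substMon k τ ((magOperad k).comp (magSingle markedMul 1) f) =
      polyMul k ι (substMon k (τ ∘ Sum.inr) f) (Finsupp.single (τ (Sum.inl ())) 1) := by
  induction f using magOperad_induction with
  | zero => simp only [map_zero, LinearMap.zero_apply]
  | add f g hf hg => simp only [map_add, LinearMap.add_apply, hf, hg]
  | single t c =>
    rw [magOperad_comp_single, substMon_single, substMon_single, polyMul_single, one_mul, mul_one]
    congr 1
    change FreeMagma.lift τ (FreeMagma.map Sum.inr t.1) * _ = _
    rw [FreeMagma.map, lift_lift]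
    rfl

theorem substMon_comp_mulMarked [Finite κ] (τ : Unit ⊕ κ → FreeMagma ι)
    (f : (magOperad k).obj κ) :
    substMon k τ ((magOperad k).comp (magSingle mulMarked 1) f) =
      polyMul k ι (Finsupp.single (τ (Sum.inl ())) 1) (substMon k (τ ∘ Sum.inr) f) := by
  induction f using magOperad_induction with
  | zero => simp only [map_zero]
  | add f g hf hg => simp only [map_add, hf, hg]
  | single t c =>
    rw [magOperad_comp_single, substMon_single, substMon_single, polyMul_single]
    congr 1
    change _ * FreeMagma.lift τ (FreeMagma.map Sum.inr t.1) = _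
    rw [FreeMagma.map, lift_lift]
    rfl

namespace SymmOperad.OperadIdeal

variable (J : OperadIdeal (magOperad k))

/-- The space of all substitution instances of the elements of an operadic ideal. -/
noncomputable def substSpan (ι : Type) : Submodule k (FreeMagma ι →₀ k) :=
  Submodule.span k {f | ∃ (κ : Type) (_ : Finite κ) (σ : κ → FreeMagma ι),
    ∃ g ∈ J.carrier κ, substMon k σ g = f}

variable {J}

theorem substMon_mem_substSpan [Finite κ] (σ : κ → FreeMagma ι) {g : (magOperad k).obj κ}
    (hg : g ∈ J.carrier κ) : substMon k σ g ∈ J.substSpan ι :=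
  Submodule.subset_span ⟨κ, inferInstance, σ, g, hg, rfl⟩

theorem polyMul_mem_right (f : FreeMagma ι →₀ k) {g : FreeMagma ι →₀ k}
    (hg : g ∈ J.substSpan ι) : polyMul k ι f g ∈ J.substSpan ι := by
  induction f using Finsupp.induction_linear with
  | zero => simp
  | add f f' hf hf' => rw [map_add, LinearMap.add_apply]; exact add_mem hf hf'
  | single t c =>
    rw [← mul_one c, ← smul_eq_mul, ← Finsupp.smul_single, map_smul, LinearMap.smul_apply]
    refine Submodule.smul_mem _ c ?_
    induction hg using Submodule.span_induction with
    | zero => simp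
    | add f g _ _ hf hg => rw [map_add]; exact add_mem hf hg
    | smul c f _ hf => rw [map_smul]; exact Submodule.smul_mem _ _ hf
    | mem f hf =>
      obtain ⟨κ, _, σ, g, hg, rfl⟩ := hf
      have h := substMon_comp_mulMarked (Sum.elim (fun _ => t) σ) g
      rw [Sum.elim_comp_inr, Sum.elim_inl] at h
      exact h ▸ substMon_mem_substSpan _ (J.comp_mem_right _ hg)

theorem polyMul_mem_left {f : FreeMagma ι →₀ k} (g : FreeMagma ι →₀ k)
    (hf : f ∈ J.substSpan ι) : polyMul k ι f g ∈ J.substSpan ι := by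
  induction g using Finsupp.induction_linear with
  | zero => simp
  | add g g' hg hg' => rw [map_add]; exact add_mem hg hg'
  | single t c =>
    rw [← mul_one c, ← smul_eq_mul, ← Finsupp.smul_single, map_smul]
    refine Submodule.smul_mem _ c ?_
    induction hf using Submodule.span_induction with
    | zero => simp
    | add f g _ _ hf hg => rw [map_add, LinearMap.add_apply]; exact add_mem hf hg
    | smul c f _ hf => rw [map_smul, LinearMap.smul_apply]; exact Submodule.smul_mem _ _ hf
    | mem f hf =>
      obtain ⟨κ, _, σ, g, hg, rfl⟩ := hf
      have h := substMon_comp_markedMul (Sum.elim (fun _ => t) σ) g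
      rw [Sum.elim_comp_inr, Sum.elim_inl] at h
      exact h ▸ substMon_mem_substSpan _ (J.comp_mem_right _ hg)

variable (J) in
/-- The free algebra on `ι` of the variety defined by an operadic ideal. -/
abbrev FreeAlg (ι : Type) : Type u := (FreeMagma ι →₀ k) ⧸ J.substSpan ι

variable (J) in
/-- The product of the relatively free algebra. -/
noncomputable def freeMul (ι : Type) : J.FreeAlg ι →ₗ[k] J.FreeAlg ι →ₗ[k] J.FreeAlg ι :=
  (J.substSpan ι).liftQ
    (LinearMap.flip ((J.substSpan ι).liftQ
      (LinearMap.flip ((polyMul k ι).compr₂ (J.substSpan ι).mkQ))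
      (by
        intro g hg
        rw [LinearMap.mem_ker]
        refine LinearMap.ext fun f => ?_
        exact (Submodule.Quotient.mk_eq_zero _).2 (polyMul_mem_right f hg))))
    (by
      intro f hf
      rw [LinearMap.mem_ker]
      refine LinearMap.ext fun g => ?_
      induction g using Submodule.Quotient.induction_on with
      | H g => exact (Submodule.Quotient.mk_eq_zero _).2 (polyMul_mem_left g hf))

variable (J) in
/-- The class of a monomial in the relatively free algebra. -/
noncomputable def monClass (t : FreeMagma ι) : J.FreeAlg ι :=
  Submodule.Quotient.mk (Finsupp.single t 1)

theorem freeMul_monClass (t s : FreeMagma ι) :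
    J.freeMul ι (J.monClass t) (J.monClass s) = J.monClass (t * s) := by
  change (J.substSpan ι).mkQ (polyMul k ι (Finsupp.single t 1) (Finsupp.single s 1)) = _
  rw [polyMul_single, mul_one]
  rfl

/-- Carries statements about values of monomials over to their classes in the free algebra. -/
theorem eval_monClass (t : FreeMagma ι) :
    FreeMagma.eval (J.freeMul ι) (fun i => J.monClass (FreeMagma.of i)) t = J.monClass t := by
  induction t with
  | ih1 i => rfl
  | ih2 s t hs ht => rw [FreeMagma.eval_mul, hs, ht, freeMul_monClass]

theorem freeAlg_induction {p : J.FreeAlg ι → Prop} (a : J.FreeAlg ι) (zero : p 0)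
    (add : ∀ a b, p a → p b → p (a + b)) (smul : ∀ (c : k) (a), p a → p (c • a))
    (monClass : ∀ t, p (J.monClass t)) : p a := by
  induction a using Submodule.Quotient.induction_on with
  | H f =>
    induction f using Finsupp.induction_linear with
    | zero => exact zero
    | add f g hf hg => exact add _ _ hf hg
    | single t c =>
      rw [← mul_one c, ← smul_eq_mul, ← Finsupp.smul_single]
      exact smul c _ (monClass t)

theorem mk_substMon_eq_zero [Finite κ] (σ : κ → FreeMagma ι) {g : (magOperad k).obj κ}
    (hg : g ∈ J.carrier κ) : (J.substSpan ι).mkQ (substMon k σ g) = 0 :=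
  (Submodule.Quotient.mk_eq_zero _).2 (substMon_mem_substSpan σ hg)

theorem mk_substMon_leftMonomial (σ : Fin 3 → FreeMagma ι) (a b c : Fin 3)
    (h : a ≠ b ∧ a ≠ c ∧ b ≠ c) : (J.substSpan ι).mkQ (substMon k σ (leftMonomial k a b c h)) =
      J.freeMul ι (J.freeMul ι (J.monClass (σ a)) (J.monClass (σ b))) (J.monClass (σ c)) := by
  rw [freeMul_monClass, freeMul_monClass]
  exact congrArg _ (substMon_single σ _ 1)

theorem mk_substMon_rightMonomial (σ : Fin 3 → FreeMagma ι) (a b c : Fin 3)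
    (h : a ≠ b ∧ a ≠ c ∧ b ≠ c) : (J.substSpan ι).mkQ (substMon k σ (rightMonomial k a b c h)) =
      J.freeMul ι (J.monClass (σ a)) (J.freeMul ι (J.monClass (σ b)) (J.monClass (σ c))) := by
  rw [freeMul_monClass, freeMul_monClass]
  exact congrArg _ (substMon_single σ _ 1)

variable (J) in
/-- The projection of the relatively free algebra to its multilinear part. -/
noncomputable def freeAlgPart (ι : Type) [Finite ι] :
    J.FreeAlg ι →ₗ[k] ((magOperad k).quotient J).obj ι :=
  (J.substSpan ι).liftQ ((J.carrier ι).mkQ ∘ₗ multilinearPart k ι) <| by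
    refine Submodule.span_le.2 ?_
    rintro _ ⟨κ, _, σ, g, hg, rfl⟩
    exact (Submodule.Quotient.mk_eq_zero _).2 (J.multilinearPart_substMon_mem σ hg)

variable (J) in
/-- The class of a multilinear monomial in the quotient operad. -/
noncomputable def opClass [Finite ι] (t : MultilinearMonomial ι) :
    ((magOperad k).quotient J).obj ι :=
  (J.carrier ι).mkQ (magSingle t 1)

theorem freeAlgPart_monClass_map [Finite ι] [Finite κ] (e : κ ≃ ι) (t : MultilinearMonomial κ) :
    J.freeAlgPart ι (J.monClass (FreeMagma.map e t.1)) =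
      ((magOperad k).quotient J).map e (J.opClass t) :=
  congrArg (J.carrier ι).mkQ (multilinearPart_single_map e t 1)

theorem freeAlgPart_monClass [Finite ι] (t : MultilinearMonomial ι) :
    J.freeAlgPart ι (J.monClass t.1) = J.opClass t :=
  congrArg (J.carrier ι).mkQ (multilinearPart_single t 1)

theorem freeAlgPart_monClass_map_of_not [Finite ι] {φ : κ → ι} (h : ¬ Function.Bijective φ)
    (t : MultilinearMonomial κ) : J.freeAlgPart ι (J.monClass (FreeMagma.map φ t.1)) = 0 :=
  (congrArg (J.carrier ι).mkQ (multilinearPart_single_map_of_not h t 1)).trans (map_zero _)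

theorem map_opClass [Finite ι] [Finite κ] (e : ι ≃ κ) (t : MultilinearMonomial ι) :
    ((magOperad k).quotient J).map e (J.opClass t) = J.opClass (t.map e) :=
  congrArg (J.carrier κ).mkQ (magOperad_map_single e t 1)

theorem comp_opClass [Finite ι] [Finite κ] (t : MultilinearMonomial (Option ι))
    (s : MultilinearMonomial κ) :
    ((magOperad k).quotient J).comp (J.opClass t) (J.opClass s) = J.opClass (t.comp s) := by
  refine congrArg (J.carrier (ι ⊕ κ)).mkQ ((magOperad_comp_single t s (1 : k) 1).trans ?_)
  rw [mul_one]

theorem span_opClass [Finite ι] :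
    Submodule.span k (Set.range (J.opClass (ι := ι))) = ⊤ := by
  refine (Submodule.eq_top_iff').2 fun f => ?_
  induction f using Submodule.Quotient.induction_on with
  | H f =>
    induction f using magOperad_induction with
    | zero => exact zero_mem _
    | add f g hf hg => exact add_mem hf hg
    | single t c =>
      have h : magSingle t c = c • magSingle t (1 : k) :=
        ((Finsupp.smul_single (α := MultilinearMonomial ι) c t 1).trans
          (by rw [smul_eq_mul, mul_one]; rfl)).symm
      rw [h]
      exact Submodule.smul_mem _ c (Submodule.subset_span (Set.mem_range_self t))

theorem subset_generate {P : SymmOperad k} {n : ℕ} {S : Set (P.obj (Fin n))} {f : P.obj (Fin n)}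
    (hf : f ∈ S) : f ∈ (OperadIdeal.generate P n S).carrier (Fin n) := by
  change f ∈ ⨅ (I : OperadIdeal P) (_ : ∀ f ∈ S, f ∈ I.carrier (Fin n)), I.carrier (Fin n)
  simp only [Submodule.mem_iInf]
  exact fun I hI => hI f hf

/-- A trilinear identity of the relatively free algebra holds if it holds for monomials. -/
theorem freeAlg_identity {T : J.FreeAlg ι → J.FreeAlg ι → J.FreeAlg ι → J.FreeAlg ι}
    (h : ∀ t s r, T (J.monClass t) (J.monClass s) (J.monClass r) = 0)
    (h₁ : ∀ b c, IsLinearMap k (T · b c)) (h₂ : ∀ a c, IsLinearMap k (T a · c))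
    (h₃ : ∀ a b, IsLinearMap k (T a b ·)) (a b c : J.FreeAlg ι) : T a b c = 0 := by
  induction a using freeAlg_induction with
  | zero => exact (h₁ b c).map_zero
  | add a a' ha ha' => rw [(h₁ b c).map_add, ha, ha', add_zero]
  | smul r a ha => rw [(h₁ b c).map_smul, ha, smul_zero]
  | monClass t =>
  induction b using freeAlg_induction with
  | zero => exact (h₂ _ c).map_zero
  | add a a' ha ha' => rw [(h₂ _ c).map_add, ha, ha', add_zero]
  | smul r a ha => rw [(h₂ _ c).map_smul, ha, smul_zero]
  | monClass s =>
  induction c using freeAlg_induction with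
  | zero => exact (h₃ _ _).map_zero
  | add a a' ha ha' => rw [(h₃ _ _).map_add, ha, ha', add_zero]
  | smul r a ha => rw [(h₃ _ _).map_smul, ha, smul_zero]
  | monClass r => exact h t s r

end SymmOperad.OperadIdeal

end RelativelyFree

/-! ### Relatively free alternative and Novikov algebras -/

section Varieties

variable (k : Type u) [CommRing k] {ι κ : Type}

/-- The ideal of identities of alternative algebras. -/
noncomputable abbrev altIdeal : OperadIdeal (magOperad k) :=
  OperadIdeal.generate (magOperad k) 3
    {leftMonomial k 0 1 2 (by decide) - rightMonomial k 0 1 2 (by decide)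
        - (-leftMonomial k 1 0 2 (by decide) + rightMonomial k 1 0 2 (by decide)),
      leftMonomial k 0 1 2 (by decide) - rightMonomial k 0 1 2 (by decide)
        - (-leftMonomial k 0 2 1 (by decide) + rightMonomial k 0 2 1 (by decide))}

/-- The ideal of identities of Novikov algebras. -/
noncomputable abbrev novIdeal : OperadIdeal (magOperad k) :=
  OperadIdeal.generate (magOperad k) 3
    {leftMonomial k 0 1 2 (by decide) - leftMonomial k 0 2 1 (by decide),
      leftMonomial k 0 1 2 (by decide) - rightMonomial k 0 1 2 (by decide)
        - (leftMonomial k 1 0 2 (by decide) - rightMonomial k 1 0 2 (by decide))}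

variable {k}

open OperadIdeal

theorem altIdeal_left (a b c : (altIdeal k).FreeAlg ι) :
    (altIdeal k).freeMul ι c ((altIdeal k).freeMul ι a b) =
      (altIdeal k).freeMul ι ((altIdeal k).freeMul ι c a) b
        + (altIdeal k).freeMul ι ((altIdeal k).freeMul ι a c) b
        - (altIdeal k).freeMul ι a ((altIdeal k).freeMul ι c b) := by
  set m := (altIdeal k).freeMul ι
  refine sub_eq_zero.1 (freeAlg_identity (J := altIdeal k)
    (T := fun a b c => m c (m a b) - (m (m c a) b + m (m a c) b - m a (m c b)))
    (fun t s r => ?_) (fun b c => ⟨fun x y => ?_, fun x y => ?_⟩)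
    (fun b c => ⟨fun x y => ?_, fun x y => ?_⟩) (fun b c => ⟨fun x y => ?_, fun x y => ?_⟩) a b c)
  -- The repositioned factor `c` is the first variable of the left alternative identity, hence the
  -- cyclic order; the goal is the negative of that instance.
  · have h := mk_substMon_eq_zero (J := altIdeal k) ![r, t, s] (subset_generate (.inl rfl))
    simp only [map_sub, map_add, map_neg, mk_substMon_leftMonomial, mk_substMon_rightMonomial] at h
    rw [← neg_eq_zero, ← h]
    simp only [Matrix.cons_val]
    abel
  all_goals
    simp only [map_add, map_smul, LinearMap.add_apply, LinearMap.smul_apply, smul_add, smul_sub]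
  all_goals abel

theorem altIdeal_right (a b c : (altIdeal k).FreeAlg ι) :
    (altIdeal k).freeMul ι ((altIdeal k).freeMul ι a b) c =
      (altIdeal k).freeMul ι a ((altIdeal k).freeMul ι b c)
        - (altIdeal k).freeMul ι ((altIdeal k).freeMul ι a c) b
        + (altIdeal k).freeMul ι a ((altIdeal k).freeMul ι c b) := by
  set m := (altIdeal k).freeMul ι
  refine sub_eq_zero.1 (freeAlg_identity (J := altIdeal k)
    (T := fun a b c => m (m a b) c - (m a (m b c) - m (m a c) b + m a (m c b)))
    (fun t s r => ?_) (fun b c => ⟨fun x y => ?_, fun x y => ?_⟩)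
    (fun b c => ⟨fun x y => ?_, fun x y => ?_⟩) (fun b c => ⟨fun x y => ?_, fun x y => ?_⟩) a b c)
  · have h := mk_substMon_eq_zero (J := altIdeal k) ![t, s, r] (subset_generate (.inr rfl))
    simp only [map_sub, map_add, map_neg, mk_substMon_leftMonomial, mk_substMon_rightMonomial] at h
    rw [← h]
    simp only [Matrix.cons_val]
    abel
  all_goals
    simp only [map_add, map_smul, LinearMap.add_apply, LinearMap.smul_apply, smul_add, smul_sub]
  all_goals abel

theorem novIdeal_right_comm (a b c : (novIdeal k).FreeAlg ι) :
    (novIdeal k).freeMul ι ((novIdeal k).freeMul ι a b) c =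
      (novIdeal k).freeMul ι ((novIdeal k).freeMul ι a c) b := by
  set m := (novIdeal k).freeMul ι
  refine sub_eq_zero.1 (freeAlg_identity (J := novIdeal k)
    (T := fun a b c => m (m a b) c - m (m a c) b)
    (fun t s r => ?_) (fun b c => ⟨fun x y => ?_, fun x y => ?_⟩)
    (fun b c => ⟨fun x y => ?_, fun x y => ?_⟩) (fun b c => ⟨fun x y => ?_, fun x y => ?_⟩) a b c)
  · have h := mk_substMon_eq_zero (J := novIdeal k) ![t, s, r] (subset_generate (.inl rfl))
    simp only [map_sub, mk_substMon_leftMonomial] at h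
    exact h
  all_goals
    simp only [map_add, map_smul, LinearMap.add_apply, LinearMap.smul_apply, smul_sub]
  all_goals abel

theorem novIdeal_left_symm (a b c : (novIdeal k).FreeAlg ι) :
    (novIdeal k).freeMul ι a ((novIdeal k).freeMul ι b c) =
      (novIdeal k).freeMul ι ((novIdeal k).freeMul ι a b) c
        - (novIdeal k).freeMul ι ((novIdeal k).freeMul ι b a) c
        + (novIdeal k).freeMul ι b ((novIdeal k).freeMul ι a c) := by
  set m := (novIdeal k).freeMul ι
  refine sub_eq_zero.1 (freeAlg_identity (J := novIdeal k)
    (T := fun a b c => m a (m b c) - (m (m a b) c - m (m b a) c + m b (m a c)))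
    (fun t s r => ?_) (fun b c => ⟨fun x y => ?_, fun x y => ?_⟩)
    (fun b c => ⟨fun x y => ?_, fun x y => ?_⟩) (fun b c => ⟨fun x y => ?_, fun x y => ?_⟩) a b c)
  · have h := mk_substMon_eq_zero (J := novIdeal k) ![t, s, r] (subset_generate (.inr rfl))
    simp only [map_sub, mk_substMon_leftMonomial, mk_substMon_rightMonomial] at h
    rw [← neg_eq_zero, ← h]
    simp only [Matrix.cons_val]
    abel
  all_goals
    simp only [map_add, map_smul, LinearMap.add_apply, LinearMap.smul_apply, smul_add, smul_sub]
  all_goals abel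

/-! ### The white Manin product -/

namespace MultilinearMonomial

/-- The composite of an operation of arity two with two operations. -/
def compTwo (b : MultilinearMonomial (Option Unit)) (t : MultilinearMonomial ι)
    (s : MultilinearMonomial κ) : MultilinearMonomial (ι ⊕ κ) :=
  (((b.comp t).map ((Equiv.sumComm Unit ι).trans (Equiv.optionEquivSumPUnit ι).symm))).comp s

theorem map_compTwo_markedMul {μ : Type} (φ : ι → μ) (ψ : κ → μ) (t : MultilinearMonomial ι)
    (s : MultilinearMonomial κ) : FreeMagma.map (Sum.elim φ ψ) (markedMul.compTwo t s).1 =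
      FreeMagma.map φ t.1 * FreeMagma.map ψ s.1 := by
  simp only [compTwo, comp, map, FreeMagma.map, lift_lift, markedMul, map_mul,
    FreeMagma.lift_of]
  simp [substFun, FreeMagma.map, lift_lift]
  rfl

theorem map_compTwo_mulMarked {μ : Type} (φ : ι → μ) (ψ : κ → μ) (t : MultilinearMonomial ι)
    (s : MultilinearMonomial κ) : FreeMagma.map (Sum.elim φ ψ) (mulMarked.compTwo t s).1 =
      FreeMagma.map ψ s.1 * FreeMagma.map φ t.1 := by
  simp only [compTwo, comp, map, FreeMagma.map, lift_lift, mulMarked, map_mul,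
    FreeMagma.lift_of]
  simp [substFun, FreeMagma.map, lift_lift]
  rfl

end MultilinearMonomial

/-- The generators are all operations on `Fin 2`, and relabelling reaches every two-element set. -/
theorem mem_whiteManin_of_card_eq_two {P Q : SymmOperad k} [Finite ι] (h : Nat.card ι = 2)
    (f : (hadamard P Q).obj ι) : f ∈ (whiteManin P Q).carrier ι := by
  have e : Fin 2 ≃ ι := (Finite.equivFinOfCardEq h).symm
  have hf : (hadamard P Q).map e.symm f ∈ (whiteManin P Q).carrier (Fin 2) := by
    change _ ∈ ⨅ (V : SubOperad (hadamard P Q)) (_ : ∀ f ∈ Set.univ, f ∈ V.carrier (Fin 2)),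
      V.carrier (Fin 2)
    simp only [Submodule.mem_iInf]
    exact fun V hV => hV _ trivial
  have := (whiteManin P Q).map_mem e hf
  rwa [← (hadamard P Q).map_trans, e.symm_trans_self, (hadamard P Q).map_refl] at this

theorem opClass_compTwo (J : OperadIdeal (magOperad k)) [Finite ι] [Finite κ]
    (b : MultilinearMonomial (Option Unit)) (t : MultilinearMonomial ι)
    (s : MultilinearMonomial κ) :
    J.opClass (b.compTwo t s) = ((magOperad k).quotient J).comp (((magOperad k).quotient J).map
      ((Equiv.sumComm Unit ι).trans (Equiv.optionEquivSumPUnit ι).symm)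
        (((magOperad k).quotient J).comp (J.opClass b) (J.opClass t))) (J.opClass s) := by
  rw [comp_opClass, map_opClass, comp_opClass]
  rfl

/-- All of arity two belongs to the Manin product, so the products `b` and `b'` used in the two
tensor factors may differ. This yields both ab ⊗ cd and ba ⊗ cd. -/
theorem tmul_compTwo_mem {J I : OperadIdeal (magOperad k)} [Finite ι] [Finite κ]
    (b b' : MultilinearMonomial (Option Unit)) {t t' : MultilinearMonomial ι}
    {s s' : MultilinearMonomial κ}
    (ht : (J.opClass t ⊗ₜ[k] I.opClass t' : (hadamard ((magOperad k).quotient J)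
      ((magOperad k).quotient I)).obj ι) ∈
        (whiteManin ((magOperad k).quotient J) ((magOperad k).quotient I)).carrier ι)
    (hs : (J.opClass s ⊗ₜ[k] I.opClass s' : (hadamard ((magOperad k).quotient J)
      ((magOperad k).quotient I)).obj κ) ∈
        (whiteManin ((magOperad k).quotient J) ((magOperad k).quotient I)).carrier κ) :
    (J.opClass (b.compTwo t s) ⊗ₜ[k] I.opClass (b'.compTwo t' s') :
      (hadamard ((magOperad k).quotient J) ((magOperad k).quotient I)).obj (ι ⊕ κ)) ∈
        (whiteManin ((magOperad k).quotient J) ((magOperad k).quotient I)).carrier (ι ⊕ κ) := by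
  set V := whiteManin ((magOperad k).quotient J) ((magOperad k).quotient I)
  have hb : (J.opClass b ⊗ₜ[k] I.opClass b' : (hadamard ((magOperad k).quotient J)
      ((magOperad k).quotient I)).obj (Option Unit)) ∈ V.carrier (Option Unit) :=
    mem_whiteManin_of_card_eq_two (by simp) _
  rw [opClass_compTwo, opClass_compTwo]
  exact V.comp_mem (V.map_mem
    ((Equiv.sumComm Unit ι).trans (Equiv.optionEquivSumPUnit ι).symm) (V.comp_mem hb ht)) hs

theorem whiteManin_altOperad_novOperad :
    whiteManin (altOperad k) (novOperad k) = ⊤ := by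
  set V := whiteManin (altOperad k) (novOperad k)
  refine SubOperad.ext ?_
  funext ι _
  refine (Submodule.eq_top_iff').2 fun f => ?_
  have key : ∀ t s : MultilinearMonomial ι,
      ((altIdeal k).opClass t ⊗ₜ[k] (novIdeal k).opClass s :
        (hadamard (altOperad k) (novOperad k)).obj ι) ∈ V.carrier ι := by
    intro t s
    -- Stability of `G` under products is required without any disjointness of variables. Pairs are
    -- therefore recorded as images, under an arbitrary common renaming `φ`, of multilinear pairs
    -- whose tensor lies in `V`.
    let G : (altIdeal k).FreeAlg ι → (novIdeal k).FreeAlg ι → Prop := fun a c =>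
      ∃ (κ : Type) (_ : Finite κ) (φ : κ → ι) (t s : MultilinearMonomial κ),
        ((altIdeal k).opClass t ⊗ₜ[k] (novIdeal k).opClass s :
          (hadamard (altOperad k) (novOperad k)).obj κ) ∈ V.carrier κ ∧
        (altIdeal k).monClass (FreeMagma.map φ t.1) = a ∧
        (novIdeal k).monClass (FreeMagma.map φ s.1) = c
    have hG : ∀ {a b c d}, G a c → G b d →
        G ((altIdeal k).freeMul ι a b) ((novIdeal k).freeMul ι c d) ∧
        G ((altIdeal k).freeMul ι b a) ((novIdeal k).freeMul ι c d) := by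
      rintro _ _ _ _ ⟨κ, _, φ, t, t', ht, rfl, rfl⟩ ⟨μ, _, ψ, s, s', hs, rfl, rfl⟩
      constructor
      · refine ⟨κ ⊕ μ, inferInstance, Sum.elim φ ψ, _, _,
          tmul_compTwo_mem markedMul markedMul ht hs, ?_, ?_⟩
        · rw [map_compTwo_markedMul, freeMul_monClass]
        · rw [map_compTwo_markedMul, freeMul_monClass]
      · refine ⟨κ ⊕ μ, inferInstance, Sum.elim φ ψ, _, _,
          tmul_compTwo_mem mulMarked markedMul ht hs, ?_, ?_⟩
        · rw [map_compTwo_mulMarked, freeMul_monClass]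
        · rw [map_compTwo_markedMul, freeMul_monClass]
    have hts : t.1.leaves = s.1.leaves :=
      (Multiset.Nodup.ext t.2.1 s.2.1).2 fun i => iff_of_true (t.2.2 i) (s.2.2 i)
    have h := FreeMagma.tmul_eval_mem_span (G := G) altIdeal_right altIdeal_left novIdeal_right_comm
      novIdeal_left_symm hG t.1 s.1 hts s.2.1
      (fun i => (altIdeal k).monClass (FreeMagma.of i))
      (fun i => (novIdeal k).monClass (FreeMagma.of i))
      (fun i => ⟨Unit, inferInstance, fun _ => i, one, one, V.one_mem, rfl, rfl⟩)
    rw [eval_monClass, eval_monClass] at h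
    -- The multilinear projections on both factors send the span into `V`: a bijective `φ` acts as a
    -- relabelling, and otherwise the tensor is sent to zero.
    have hmap : Submodule.span k {f | ∃ a c, G a c ∧ a ⊗ₜ[k] c = f} ≤
        (V.carrier ι).comap (TensorProduct.map ((altIdeal k).freeAlgPart ι)
          ((novIdeal k).freeAlgPart ι)) := by
      refine Submodule.span_le.2 ?_
      rintro _ ⟨_, _, ⟨κ, _, φ, t, s, ht, rfl, rfl⟩, rfl⟩
      change (altIdeal k).freeAlgPart ι _ ⊗ₜ[k] (novIdeal k).freeAlgPart ι _ ∈ V.carrier ι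
      by_cases hφ : Function.Bijective φ
      · have h₁ := freeAlgPart_monClass_map (J := altIdeal k) (Equiv.ofBijective φ hφ) t
        have h₂ := freeAlgPart_monClass_map (J := novIdeal k) (Equiv.ofBijective φ hφ) s
        rw [Equiv.coe_ofBijective] at h₁ h₂
        rw [h₁, h₂]
        exact V.map_mem (Equiv.ofBijective φ hφ) ht
      · rw [freeAlgPart_monClass_map_of_not hφ, TensorProduct.zero_tmul]
        exact zero_mem _
    rw [← freeAlgPart_monClass, ← freeAlgPart_monClass]
    exact hmap h
  have hspan : Submodule.span k (Set.image2 (fun a b => a ⊗ₜ[k] b)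
      (Set.range ((altIdeal k).opClass (ι := ι))) (Set.range ((novIdeal k).opClass (ι := ι))))
      = ⊤ := by
    rw [← TensorProduct.map₂_mk_top_top_eq_top, ← span_opClass, ← span_opClass,
      Submodule.map₂_span_span]
    rfl
  have hle : Submodule.span k (Set.image2 (fun a b => a ⊗ₜ[k] b)
      (Set.range ((altIdeal k).opClass (ι := ι))) (Set.range ((novIdeal k).opClass (ι := ι))))
      ≤ V.carrier ι := by
    refine Submodule.span_le.2 ?_
    rintro _ ⟨_, ⟨t, rfl⟩, _, ⟨s, rfl⟩, rfl⟩
    exact key t s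
  exact hle (hspan ▸ Submodule.mem_top)

end Varieties

theorem mainTheorem6 (k : Type u) [Field k] :
    SymmOperad.whiteManin (altOperad k) (novOperad k) = ⊤ :=
  whiteManin_altOperad_novOperad
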